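/- Two users $A,B$ transmit blocks of $n$ BPSK symbols $\pm\sqrt P$ in orthogonal time slots over independent block-fading links to a relay $R$ and a destination $D$; the message blocks are independent of each other (with arbitrary distributions) and of gains and noise. The gains $h_{A,D},h_{B,D},h_{R,D}$ are i.i.d. circularly symmetric complex Gaussian (Rayleigh fading), with $|h|^2$ exponential of rate $\Omega=\Omega_{\to D}>0$, i.e. $\mathrm E\,e^{-S|h|^2}=\Omega/(S+\Omega)$; they are constant during a block. The noise samples at the destination are i.i.d. $\mathcal{CN}(0,N_0)$. The user-relay links are independent Rayleigh block-fading links (exponential squared gains of rate $\Omega_{\to R}>0$) with independent $\mathcal{CN}(0,N_R)$ noise, $N_R>0$. All gains and noises are independent. The relay applies to each user's link an arbitrary (measurable) decoder, and its decoding errors are always detected (error-free cooperation). In state $s_0$ (neither block decoded correctly) it is silent; in $s_1$ (only $A$'s) and $s_2$ (only $B$'s) it sends the decoded user's modulated block; in $s_3$ (both) it sends the sum of the two modulated blocks. With $p_{AR},p_{BR}$ the probabilities that the relay fails to decode $A$'s, $B$'s block, $$p_0=\Pr(s_0)=p_{AR}p_{BR},\quad p_1=\Pr(s_1)=(1-p_{AR})p_{BR},\quad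 p_2=\Pr(s_2)=p_{AR}(1-p_{BR}),\quad p_3=\Pr(s_3)=(1-p_{AR})(1-p_{BR}).$$ The destination knows its gains and the state. A user whose block is not relayed is detected coherently from the direct transmission; in $s_1$, $s_2$ the relayed user is detected by maximum ratio combining (MRC) of the direct and relay receptions. In $s_3$ the user $u$ with the larger $$\mathrm{SNR}_{u}=\Big(|h_{u,D}|^2+\frac{|h_{v,D}h_{R,D}|^2}{|h_{v,D}|^2+|h_{R,D}|^2}\Big)\frac P{N_0}\qquad(v\ne u\text{ the other user})$$ is detected first, by nulling the other user's signal (projecting the received vector orthogonally to it) followed by MRC. Its contribution is then subtracted from the relay reception, and the second user is detected by MRC of the direct and relay receptions; error propagation is excluded, i.e. the true symbol of the first user is subtracted. Let $P_{b,u}$ be the bit error probability of user $u$ (at any position in the block), let $P,N_0>0$, $\mathrm{snr}_0=P/N_0$, and let $F(a,b;c;z)$ be the Gauss hypergeometric function. Then $$\begin{aligned}P_{b,A}\le{}&\frac12\Big[(p_0+p_2)\frac{\Omega}{\mathrm{snr}_0+\Omega}+p_1\Big(\frac{\Omega}{\mathrm{snr}_0+\Omega}\Big)^2\Big]\\&+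\frac{p_3}4\Big[\frac{\Omega}{\Omega+\mathrm{snr}_0}\sqrt\pi\,\Omega^2\Big(\frac{32\,\Omega}{\Gamma(2.5)(4\Omega+\mathrm{snr}_0)^3}F\big(3,1.5;2.5;\tfrac{\mathrm{snr}_0}{4\Omega+\mathrm{snr}_0}\big)+\frac{4}{\Gamma(2.5)(4\Omega+\mathrm{snr}_0)^2}F\big(2,0.5;2.5;\tfrac{\mathrm{snr}_0}{4\Omega+\mathrm{snr}_0}\big)\Big)+\Big(\frac{\Omega}{\Omega+\mathrm{snr}_0}\Big)^2\Big],\end{aligned}$$ and the same bound with $p_1$ and $p_2$ exchanged holds for $P_{b,B}$. -/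

import Mathlib

open MeasureTheory ProbabilityTheory

noncomputable section

namespace MARC

/-- The two users sharing the relay. -/
inductive User
  | A
  | B
  deriving DecidableEq

instance : Fintype User where
  elems := {User.A, User.B}
  complete := by intro u; cases u <;> simp

/-- The user that is not `u`. -/
def User.other : User → User
  | .A => .B
  | .B => .A

/-- A block of `n` bits. -/
abbrev Block (n : ℕ) : Type := Fin n → Bool

/-- The circularly symmetric complex Gaussian law `CN(0, v)`: independent real and imaginary
parts, each centred Gaussian of variance `v / 2`. -/
def complexGaussian (v : ℝ) : Measure ℂ :=
  ((gaussianReal 0 (v / 2).toNNReal).prod (gaussianReal 0 (v / 2).toNNReal)).map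
    (fun p : ℝ × ℝ => (⟨p.1, p.2⟩ : ℂ))

/-- Everything that is random during the transmission of one block. -/
abbrev Sample (n : ℕ) : Type :=
  -- the message blocks of the users
  (User → Block n) ×
  -- the user-relay links: block fading gains, noise in each symbol interval
  ((User → ℂ) × (User → Fin n → ℂ)) ×
  -- the links to the destination: gains of the two users, gain of the relay
  ((User → ℂ) × ℂ) ×
  -- noise at the destination in the slots of the two users and in the slot of the relay
  ((User → Fin n → ℂ) × (Fin n → ℂ))

namespace Sample

variable {n : ℕ}

/-- The block of bits of user `u`. -/
def msg (ω : Sample n) (u : User) : Block n := ω.1 u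

/-- Gain of the link from user `u` to the relay. -/
def gainUR (ω : Sample n) (u : User) : ℂ := ω.2.1.1 u

/-- Noise at the relay in the slot of user `u`. -/
def noiseUR (ω : Sample n) (u : User) (j : Fin n) : ℂ := ω.2.1.2 u j

/-- Gain of the link from user `u` to the destination. -/
def gainUD (ω : Sample n) (u : User) : ℂ := ω.2.2.1.1 u

/-- Gain of the link from the relay to the destination. -/
def gainRD (ω : Sample n) : ℂ := ω.2.2.1.2

/-- Noise at the destination in the slot of user `u`. -/
def noiseUD (ω : Sample n) (u : User) (j : Fin n) : ℂ := ω.2.2.2.1 u j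

/-- Noise at the destination in the slot of the relay. -/
def noiseRD (ω : Sample n) (j : Fin n) : ℂ := ω.2.2.2.2 j

end Sample

/-- The joint law. The message block of user `u` has law `M u`; gains are `CN(0, 1 / ΩR)` on the
user-relay links and `CN(0, 1 / ΩD)` on the links to the destination, so that their squared moduli
are exponential with rates `ΩR` and `ΩD`; noise samples are `CN(0, NR)` at the relay and
`CN(0, N0)` at the destination; all of these are independent. -/
def law {n : ℕ} (M : User → Measure (Block n)) (ΩR ΩD NR N0 : ℝ) : Measure (Sample n) :=
  (Measure.pi M).prod
    (((Measure.pi fun _ : User => complexGaussian (1 / ΩR)).prod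
        (Measure.pi fun _ : User => Measure.pi fun _ : Fin n => complexGaussian NR)).prod
      (((Measure.pi fun _ : User => complexGaussian (1 / ΩD)).prod
          (complexGaussian (1 / ΩD))).prod
        ((Measure.pi fun _ : User => Measure.pi fun _ : Fin n => complexGaussian N0).prod
          (Measure.pi fun _ : Fin n => complexGaussian N0))))

/-- BPSK with power `P`. -/
def bpsk (P : ℝ) (b : Bool) : ℂ := if b then (√P : ℂ) else -(√P : ℂ)

/-- The BPSK decision on a decision statistic. -/
def slicer (z : ℂ) : Bool := decide (0 ≤ z.re)

/-! ### The relay -/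

/-- A pair of decoders at the relay, one for each user: from the gain of the link and the received
block to an estimate of the transmitted block. -/
abbrev RelayDecoder (n : ℕ) : Type := User → ℂ → (Fin n → ℂ) → Block n

/-- Which blocks the relay has decoded correctly: `s0` none, `s1` only the one of user `A`,
`s2` only the one of user `B`, `s3` both. -/
inductive RelayState
  | s0
  | s1
  | s2
  | s3

/-- The state in which the relay has decoded the block of user `u` only. -/
def RelayState.only : User → RelayState
  | .A => .s1
  | .B => .s2

section Transmission

variable {n : ℕ}

/-- The block received by the relay from user `u`. -/
def relayRx (P : ℝ) (ω : Sample n) (u : User) (j : Fin n) : ℂ :=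
  ω.gainUR u * bpsk P (ω.msg u j) + ω.noiseUR u j

/-- The relay's estimate of the block of user `u`. -/
def relayEst (D : RelayDecoder n) (P : ℝ) (ω : Sample n) (u : User) : Block n :=
  D u (ω.gainUR u) (relayRx P ω u)

/-- The state of the relay. A decoding error is always detected. -/
def relayState (D : RelayDecoder n) (P : ℝ) (ω : Sample n) : RelayState :=
  if relayEst D P ω .A = ω.msg .A then
    if relayEst D P ω .B = ω.msg .B then .s3 else .s1
  else
    if relayEst D P ω .B = ω.msg .B then .s2 else .s0

/-- The signal sent by the relay: silence, the estimate of one user, or the sum of the modulated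
estimates of both users. -/
def relayTx (D : RelayDecoder n) (P : ℝ) (ω : Sample n) (j : Fin n) : ℂ :=
  match relayState D P ω with
  | .s0 => 0
  | .s1 => bpsk P (relayEst D P ω .A j)
  | .s2 => bpsk P (relayEst D P ω .B j)
  | .s3 => bpsk P (relayEst D P ω .A j) + bpsk P (relayEst D P ω .B j)

/-- The signal received by the destination in the slot of user `u`. -/
def destRxUser (P : ℝ) (ω : Sample n) (u : User) (j : Fin n) : ℂ :=
  ω.gainUD u * bpsk P (ω.msg u j) + ω.noiseUD u j

/-- The signal received by the destination in the slot of the relay. -/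
def destRxRelay (D : RelayDecoder n) (P : ℝ) (ω : Sample n) (j : Fin n) : ℂ :=
  ω.gainRD * relayTx D P ω j + ω.noiseRD j

end Transmission

/-! ### The destination

Here `h` are the gains of the users, `hR` is the gain of the relay, `y` are the samples received
from the users and `yR` is the sample received from the relay. -/

/-- Detection from the direct transmission. -/
def directDetect (h y : ℂ) : Bool := slicer (star h * y)

/-- Maximum ratio combining of two receptions with gains `h₁`, `h₂` and equal noise power. -/
def mrcDetect (h₁ y₁ h₂ y₂ : ℂ) : Bool := slicer (star h₁ * y₁ + star h₂ * y₂)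

/-- The norm `√(|h_v|² + |h_R|²)` of the vector `(h_v, h_R)` carrying the signal of the
interfering user `v`. -/
def interfNorm (hv hR : ℂ) : ℝ := √(‖hv‖ ^ 2 + ‖hR‖ ^ 2)

/-- The projection of the received samples `(y_v, y_R)` on the unit vector orthogonal to
`(h_v, h_R)`: the signal of the interfering user `v` is nulled. -/
def nulled (hv hR yv yR : ℂ) : ℂ := (hv * yR - hR * yv) / (interfNorm hv hR : ℂ)

/-- The gain of the other user in the nulled sample. -/
def nulledGain (hv hR : ℂ) : ℂ := hR * hv / (interfNorm hv hR : ℂ)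

/-- Nulling of the other user, followed by maximum ratio combining with the direct reception. -/
def nullingDetect (h : User → ℂ) (hR : ℂ) (y : User → ℂ) (yR : ℂ) (u : User) : Bool :=
  mrcDetect (h u) (y u) (nulledGain (h u.other) hR) (nulled (h u.other) hR (y u.other) yR)

/-- The signal to noise ratio of user `u` after nulling and maximum ratio combining. -/
def nullingSNR (P N0 : ℝ) (h : User → ℂ) (hR : ℂ) (u : User) : ℝ :=
  (‖h u‖ ^ 2 + ‖h u.other * hR‖ ^ 2 / (‖h u.other‖ ^ 2 + ‖hR‖ ^ 2)) * (P / N0)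

/-- The user with the highest signal to noise ratio, who is detected first. -/
def firstUser (P N0 : ℝ) (h : User → ℂ) (hR : ℂ) : User :=
  if nullingSNR P N0 h hR .B ≤ nullingSNR P N0 h hR .A then .A else .B

/-- The V-BLAST detector. The first user is detected by nulling. The contribution of that user to
the sample received from the relay, whose symbol is taken to be `xFirst`, is then subtracted, and
the second user is detected by maximum ratio combining. -/
def vblastDetect (P N0 : ℝ) (h : User → ℂ) (hR : ℂ) (y : User → ℂ) (yR xFirst : ℂ)
    (u : User) : Bool :=
  if u = firstUser P N0 h hR then nullingDetect h hR y yR u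
  else mrcDetect (h u) (y u) hR (yR - hR * xFirst)

section Performance

variable {n : ℕ}

/-- The decision of the destination on bit `j` of user `u`. The destination knows the gains and the
state of the relay. Errors do not propagate: in state `s3` the true symbol of the user who is
detected first is cancelled. -/
def detected (D : RelayDecoder n) (P N0 : ℝ) (ω : Sample n) (u : User) (j : Fin n) : Bool :=
  let direct := directDetect (ω.gainUD u) (destRxUser P ω u j)
  let mrc := mrcDetect (ω.gainUD u) (destRxUser P ω u j) ω.gainRD (destRxRelay D P ω j)
  match relayState D P ω, u with
  | .s0, _ => direct
  | .s1, .A => mrc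
  | .s1, .B => direct
  | .s2, .A => direct
  | .s2, .B => mrc
  | .s3, u =>
    vblastDetect P N0 ω.gainUD ω.gainRD (fun v => destRxUser P ω v j) (destRxRelay D P ω j)
      (bpsk P (ω.msg (firstUser P N0 ω.gainUD ω.gainRD) j)) u

/-- The bit error probability of bit `j` of user `u` under the law `μ`. -/
def bitErrorProb (μ : Measure (Sample n)) (D : RelayDecoder n) (P N0 : ℝ) (u : User)
    (j : Fin n) : ℝ :=
  μ.real {ω | detected D P N0 ω u j ≠ ω.msg u j}

/-- The probability that the relay does not decode the block of user `u` correctly. -/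
def relayFailProb (μ : Measure (Sample n)) (D : RelayDecoder n) (P : ℝ) (u : User) : ℝ :=
  μ.real {ω | relayEst D P ω u ≠ ω.msg u}

/-- The state probabilities `p₀, p₁, p₂, p₃`. -/
def stateProb (μ : Measure (Sample n)) (D : RelayDecoder n) (P : ℝ) : RelayState → ℝ
  | .s0 => relayFailProb μ D P .A * relayFailProb μ D P .B
  | .s1 => (1 - relayFailProb μ D P .A) * relayFailProb μ D P .B
  | .s2 => relayFailProb μ D P .A * (1 - relayFailProb μ D P .B)
  | .s3 => (1 - relayFailProb μ D P .A) * (1 - relayFailProb μ D P .B)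

end Performance


end MARC

end

/-!
The bound follows by conditioning on the state of the relay. For fixed messages the state depends
only on the user-relay links, so it is independent of the gains and the noise at the destination
(`law_state_error_le`, `bitErrorProb_le`), and it remains to bound the error probability of the
destination in each state. The state probabilities factor because the two user-relay links are
independent (`map_slice_law`, `law_relayState`).

Given the gains, every detector is a sign decision on `G x + w`, where `x = ±√P`, `G` is a sum of
squared moduli of effective gains and `w` is Gaussian noise of power proportional to `G`
(`destNoiseLaw_error`). The conditional error probability is therefore `Q(√(2 G P / N0))`, the
function `gaussianTail`, with `Q` the standard Gaussian tail. The squared gains are independent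
exponential variables (`map_normSq_complexGaussian`). Let `a`, `b`, `c` be those of the user, of the
other user and of the relay, and put `s = P / N0`. Without nulling, `Q(√(2 x)) ≤ exp(-x) / 2`
suffices. In the state in which both blocks are relayed, the user is detected first exactly if
`b ≤ a` (`nullingSqGain_le_iff`), up to a null event of ties, and there are two contributions.

* If the user is detected first, its signal to noise ratio is the larger one. By the symmetry that
  exchanges `a` and `b`, the average of `exp(-s (a + b c / (b + c)))` over this event is at most
  half of the full average (`lintegral_gaussianTail_first_le`). The latter factors, and the substitution
  `c = b (1 - y) / (1 + y)` gives a power series in `s / (4 Ω + s)` (`lintegral_exp_neg_harmonic`),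
  which a contiguity relation identifies with the stated combination of hypergeometric functions
  (`hasSum_hypergeometric_bound`).
* If the user is detected second, its direct gain is the smaller one, and the exponential bound of
  the tail would lose too much. Instead `Q` is written as an integral and the gains are integrated
  first: `P(a ≤ b, a + c ≤ t) = (1 - exp(-Ω t))² / 2`. This yields the closed form
  `(1 - 2 √(s / (s + Ω)) + √(s / (s + 2 Ω))) / 4`, which is at most `(Ω / (Ω + s))² / 4` by
  `one_sub_two_mul_sqrt_add_sqrt_le` (`lintegral_gaussianTail_second_le`).
-/

namespace MARC

open Set ENNReal

/-! ### A contiguity relation for the hypergeometric function -/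

lemma ascPochhammer_eval_mul_add (b : ℝ) (n : ℕ) :
    (ascPochhammer ℝ n).eval b * (b + n) = b * (ascPochhammer ℝ n).eval (b + 1) := by
  induction n with
  | zero => simp
  | succ n ih =>
    rw [ascPochhammer_succ_eval, ascPochhammer_succ_eval, ih]
    push_cast
    ring

lemma ascPochhammer_eval_two (n : ℕ) :
    (ascPochhammer ℝ n).eval 2 = (n + 1) * n.factorial := by
  have h := ascPochhammer_eval_mul_add 1 n
  rw [ascPochhammer_eval_one, one_mul, one_add_one_eq_two] at h
  linarith

lemma ascPochhammer_eval_three (n : ℕ) :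
    (ascPochhammer ℝ n).eval 3 = (n + 1) * (n + 2) / 2 * n.factorial := by
  have h := ascPochhammer_eval_mul_add 2 n
  rw [ascPochhammer_eval_two, two_add_one_eq_three] at h
  linarith

lemma ascPochhammer_eval_div_add_one {b : ℝ} (hb : 0 < b) (n : ℕ) :
    (ascPochhammer ℝ n).eval b * ((ascPochhammer ℝ n).eval (b + 1))⁻¹ = b / (b + n) := by
  have h := ascPochhammer_eval_mul_add b n
  have h1 : 0 < (ascPochhammer ℝ n).eval (b + 1) := ascPochhammer_pos n _ (by linarith)
  field_simp
  linarith

lemma hasSum_ordinaryHypergeometric {a b c : ℝ} (ha : 0 < a) (hb : 0 < b) (hc : 0 < c) {q : ℝ}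
    (hq0 : 0 ≤ q) (hq : q < 1) :
    HasSum (fun n : ℕ => ((n.factorial : ℝ)⁻¹ * (ascPochhammer ℝ n).eval a *
      (ascPochhammer ℝ n).eval b * ((ascPochhammer ℝ n).eval c)⁻¹) * q ^ n)
      (ordinaryHypergeometric a b c q) := by
  have hr : (ordinaryHypergeometricSeries ℝ a b c).radius = 1 := by
    apply ordinaryHypergeometricSeries_radius_eq_one
    intro k
    have : (0 : ℝ) ≤ k := k.cast_nonneg
    refine ⟨?_, ?_, ?_⟩ <;> linarith
  have h := (ordinaryHypergeometricSeries ℝ a b c).hasSum (x := q) (by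
    rw [hr, mem_eball_zero_iff, enorm_eq_nnnorm]
    have : ‖q‖₊ < 1 := by
      rw [← NNReal.coe_lt_coe, coe_nnnorm, Real.norm_of_nonneg hq0]; simpa using hq
    exact_mod_cast this)
  simp only [ordinaryHypergeometricSeries_apply_eq, smul_eq_mul] at h
  exact h

lemma hasSum_ordinaryHypergeometric_three {q : ℝ} (hq0 : 0 ≤ q) (hq : q < 1) :
    HasSum (fun n : ℕ => (n + 1) * (n + 2) / 2 * (3 / (2 * n + 3)) * q ^ n)
      (ordinaryHypergeometric (3 : ℝ) 1.5 2.5 q) := by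
  convert! hasSum_ordinaryHypergeometric (a := 3) (b := 1.5) (c := 2.5) (by norm_num)
    (by norm_num) (by norm_num) hq0 hq using 3 with n
  have h := ascPochhammer_eval_div_add_one (b := 1.5) (by norm_num) n
  norm_num only at h ⊢
  rw [mul_assoc _ (Polynomial.eval (3 / 2 : ℝ) _), h, ascPochhammer_eval_three]
  have : (n.factorial : ℝ) ≠ 0 := by positivity
  field_simp
  ring

lemma hasSum_ordinaryHypergeometric_two {q : ℝ} (hq0 : 0 ≤ q) (hq : q < 1) :
    HasSum (fun n : ℕ => (n + 1) * (3 / ((2 * n + 1) * (2 * n + 3))) * q ^ n)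
      (ordinaryHypergeometric (2 : ℝ) 0.5 2.5 q) := by
  convert! hasSum_ordinaryHypergeometric (a := 2) (b := 0.5) (c := 2.5) (by norm_num)
    (by norm_num) (by norm_num) hq0 hq using 3 with n
  have h1 := ascPochhammer_eval_div_add_one (b := 0.5) (by norm_num) n
  have h2 := ascPochhammer_eval_div_add_one (b := 1.5) (by norm_num) n
  norm_num only at h1 h2 ⊢
  have h3 : (ascPochhammer ℝ n).eval (3 / 2 : ℝ) ≠ 0 := (ascPochhammer_pos n _ (by norm_num)).ne'
  have h : (ascPochhammer ℝ n).eval (1 / 2 : ℝ) * ((ascPochhammer ℝ n).eval (5 / 2 : ℝ))⁻¹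
      = (1 / 2 / (1 / 2 + n)) * (3 / 2 / (3 / 2 + n)) := by
    rw [← h1, ← h2]
    field_simp
  rw [mul_assoc _ (Polynomial.eval (1 / 2 : ℝ) _), h, ascPochhammer_eval_two]
  have : (n.factorial : ℝ) ≠ 0 := by positivity
  field_simp
  ring

/-- The relation `2 (1 - q) F(3, 3/2; 5/2; q) + F(2, 1/2; 5/2; q) = 3 F(2, 1/2; 3/2; q)`, with the
power series on the right written out. -/
lemma hasSum_hypergeometric_contiguous {q : ℝ} (hq0 : 0 ≤ q) (hq : q < 1) :
    HasSum (fun n : ℕ => 3 * ((n + 1) / (2 * n + 1)) * q ^ n)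
      (2 * (1 - q) * ordinaryHypergeometric (3 : ℝ) 1.5 2.5 q
        + ordinaryHypergeometric (2 : ℝ) 0.5 2.5 q) := by
  have h3 := hasSum_ordinaryHypergeometric_three hq0 hq
  have h2 := hasSum_ordinaryHypergeometric_two hq0 hq
  have h3' := (hasSum_nat_add_iff' 1).2 h3
  have h2' := (hasSum_nat_add_iff' 1).2 h2
  refine (hasSum_nat_add_iff' 1).1 ?_
  convert! (((h3'.mul_left 2).sub (h3.mul_left (2 * q))).add h2') using 1
  · funext n
    push_cast
    field_simp
    ring
  · simp only [Finset.range_one, Finset.sum_singleton]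
    norm_num
    ring

lemma Gamma_five_halves : Real.Gamma 2.5 = 3 / 4 * √Real.pi := by
  rw [show (2.5 : ℝ) = 1 / 2 + 1 + 1 by norm_num, Real.Gamma_add_one (by norm_num),
    Real.Gamma_add_one (by norm_num), Real.Gamma_one_half_eq]
  ring

/-- The hypergeometric expression of the bound as a power series. -/
lemma hasSum_hypergeometric_bound {Ω s : ℝ} (hΩ : 0 < Ω) (hs : 0 < s) :
    HasSum (fun n : ℕ => 16 * Ω ^ 2 / (4 * Ω + s) ^ 2 *
        ((n + 1) / (2 * n + 1) * (s / (4 * Ω + s)) ^ n))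
      (√Real.pi * Ω ^ 2 *
        (32 * Ω / (Real.Gamma 2.5 * (4 * Ω + s) ^ 3)
            * ordinaryHypergeometric (3 : ℝ) 1.5 2.5 (s / (4 * Ω + s))
          + 4 / (Real.Gamma 2.5 * (4 * Ω + s) ^ 2)
            * ordinaryHypergeometric (2 : ℝ) 0.5 2.5 (s / (4 * Ω + s)))) := by
  have hq : s / (4 * Ω + s) < 1 := by rw [div_lt_one (by positivity)]; linarith
  have h := (hasSum_hypergeometric_contiguous (q := s / (4 * Ω + s)) (by positivity) hq).mul_left
    (16 * Ω ^ 2 / (4 * Ω + s) ^ 2 / 3)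
  convert! h using 1
  · funext n; ring
  · rw [Gamma_five_halves]
    generalize ordinaryHypergeometric (3 : ℝ) 1.5 2.5 (s / (4 * Ω + s)) = F
    generalize ordinaryHypergeometric (2 : ℝ) 0.5 2.5 (s / (4 * Ω + s)) = G
    have : √Real.pi ≠ 0 := by positivity
    field_simp
    ring

/-! ### The elementary inequality for the user detected second -/

lemma one_sub_two_mul_sqrt_add_sqrt_le {s : ℝ} (hs : 0 < s) :
    1 - 2 * √(s / (1 + s)) + √(s / (2 + s)) ≤ (1 / (1 + s)) ^ 2 := by
  set u := √(s / (1 + s)) with hu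
  have hu0 : 0 ≤ u := Real.sqrt_nonneg _
  have husq : u ^ 2 = s / (1 + s) := Real.sq_sqrt (by positivity)
  have hu1 : u ^ 2 < 1 := by rw [husq, div_lt_one (by positivity)]; linarith
  have hult : u < 1 := by nlinarith
  have h1 : 1 / (1 + s) = 1 - u ^ 2 := by rw [husq]; field_simp; ring
  have h2 : s / (2 + s) = u ^ 2 / (2 - u ^ 2) := by
    have : 2 - u ^ 2 = (2 + s) / (1 + s) := by rw [husq]; field_simp; ring
    rw [this, husq]
    field_simp
  have hw : 0 ≤ 2 - 2 * u + u ^ 3 := by nlinarith [pow_nonneg hu0 3]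
  have key : √(s / (2 + s)) ≤ u * (2 - 2 * u + u ^ 3) := by
    rw [h2]
    apply Real.sqrt_le_iff.2 ⟨mul_nonneg hu0 hw, ?_⟩
    rw [div_le_iff₀ (by linarith), mul_pow, mul_assoc]
    apply le_mul_of_one_le_right (sq_nonneg u)
    -- the difference has the double zero `u = 1`
    have h : (2 - 2 * u + u ^ 3) ^ 2 * (2 - u ^ 2) - 1 =
        (1 - u) ^ 2 * (2 + (1 - u) * (5 + 3 * u - 4 * u ^ 2) + u ^ 4 * (3 - 2 * u - u ^ 2)) := by
      ring
    have h3 : 0 ≤ (1 - u) * (5 + 3 * u - 4 * u ^ 2) :=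
      mul_nonneg (by linarith) (by linarith)
    have h4 : 0 ≤ u ^ 4 * (3 - 2 * u - u ^ 2) := mul_nonneg (by positivity) (by linarith)
    have := mul_nonneg (sq_nonneg (1 - u))
      (by linarith : 0 ≤ 2 + (1 - u) * (5 + 3 * u - 4 * u ^ 2) + u ^ 4 * (3 - 2 * u - u ^ 2))
    linarith
  rw [h1]
  nlinarith

/-! ### Exponential variables -/

lemma lintegral_expMeasure (Ω : ℝ) {f : ℝ → ℝ≥0∞} (hf : Measurable f) :
    ∫⁻ x, f x ∂expMeasure Ω = ∫⁻ x in Ioi 0, ENNReal.ofReal (Ω * Real.exp (-(Ω * x))) * f x := by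
  have h : expMeasure Ω = volume.withDensity (exponentialPDF Ω) := rfl
  rw [h, lintegral_withDensity_eq_lintegral_mul _
    (show Measurable (exponentialPDF Ω) from (measurable_exponentialPDFReal Ω).ennreal_ofReal) hf,
    ← lintegral_indicator measurableSet_Ioi]
  have h0 : ∀ᵐ x : ℝ, x ≠ 0 := by simp [ae_iff]
  refine lintegral_congr_ae ?_
  filter_upwards [h0] with x hx
  rcases lt_or_gt_of_ne hx with hx | hx
  · simp [exponentialPDF_of_neg hx, hx.le]
  · simp [exponentialPDF_of_nonneg hx.le, hx]

lemma noAtoms_expMeasure (Ω x : ℝ) : expMeasure Ω {x} = 0 := by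
  have h : expMeasure Ω = volume.withDensity (exponentialPDF Ω) := rfl
  rw [h]
  exact withDensity_absolutelyContinuous _ _ (by simp)

lemma ae_pos_expMeasure (Ω : ℝ) : ∀ᵐ x ∂expMeasure Ω, 0 < x := by
  have h : (expMeasure Ω) (Iic 0) = 0 := by
    rw [← lintegral_indicator_one measurableSet_Iic,
      lintegral_expMeasure Ω (measurable_one.indicator measurableSet_Iic)]
    rw [setLIntegral_congr_fun (g := fun _ => 0) measurableSet_Ioi]
    · simp
    · intro x hx
      simp [not_le.2 (mem_Ioi.1 hx)]
  rw [ae_iff]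
  convert h using 2
  ext x; simp

lemma lintegral_exp_neg_mul_Ioi {k : ℝ} (hk : 0 < k) :
    ∫⁻ x in Ioi (0 : ℝ), ENNReal.ofReal (Real.exp (-(k * x))) = ENNReal.ofReal (1 / k) := by
  have h := integral_exp_mul_Ioi (a := -k) (by linarith) 0
  have hi := exp_neg_integrableOn_Ioi 0 hk
  simp only [neg_mul] at h hi
  rw [← ofReal_integral_eq_lintegral_ofReal hi (by filter_upwards with x; positivity), h]
  simp

lemma lintegral_exp_neg_expMeasure {Ω s : ℝ} (hΩ : 0 < Ω) (hs : 0 ≤ s) :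
    ∫⁻ x, ENNReal.ofReal (Real.exp (-(s * x))) ∂expMeasure Ω = ENNReal.ofReal (Ω / (Ω + s)) := by
  rw [lintegral_expMeasure Ω (by fun_prop)]
  have (x : ℝ) : ENNReal.ofReal (Ω * Real.exp (-(Ω * x))) * ENNReal.ofReal (Real.exp (-(s * x)))
      = ENNReal.ofReal Ω * ENNReal.ofReal (Real.exp (-((Ω + s) * x))) := by
    rw [← ENNReal.ofReal_mul (by positivity), ← ENNReal.ofReal_mul hΩ.le, mul_assoc,
      ← Real.exp_add]
    ring_nf
  simp_rw [this]
  rw [lintegral_const_mul _ (by fun_prop), lintegral_exp_neg_mul_Ioi (by linarith),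
    ← ENNReal.ofReal_mul hΩ.le]
  ring_nf

lemma expMeasure_Iic {Ω : ℝ} (hΩ : 0 < Ω) {x : ℝ} (hx : 0 ≤ x) :
    expMeasure Ω (Iic x) = ENNReal.ofReal (1 - Real.exp (-(Ω * x))) := by
  have := isProbabilityMeasure_expMeasure hΩ
  rw [← ofReal_cdf, cdf_expMeasure_eq hΩ, if_pos hx]

lemma expMeasure_Ici {Ω : ℝ} (hΩ : 0 < Ω) {x : ℝ} (hx : 0 ≤ x) :
    expMeasure Ω (Ici x) = ENNReal.ofReal (Real.exp (-(Ω * x))) := by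
  have := isProbabilityMeasure_expMeasure hΩ
  have h1 : expMeasure Ω (Ici x) = expMeasure Ω (Ioi x) := by
    rw [← Ioi_union_left, measure_union (by simp) (by simp), noAtoms_expMeasure, add_zero]
  have h0 : Real.exp (-(Ω * x)) ≤ 1 := Real.exp_le_one_iff.2 (by nlinarith)
  rw [h1, ← compl_Iic, prob_compl_eq_one_sub measurableSet_Iic, expMeasure_Iic hΩ hx,
    ← ENNReal.ofReal_one, ← ENNReal.ofReal_sub _ (by linarith)]
  ring_nf

/-- The joint law of three independent exponential variables of rate `Ω`: the squared gains
`(a, (b, c))` of a user, of the other user and of the relay. -/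
noncomputable def sqGainLaw (Ω : ℝ) : Measure (ℝ × ℝ × ℝ) :=
  (expMeasure Ω).prod ((expMeasure Ω).prod (expMeasure Ω))

lemma isProbabilityMeasure_sqGainLaw {Ω : ℝ} (hΩ : 0 < Ω) :
    IsProbabilityMeasure (sqGainLaw Ω) := by
  have := isProbabilityMeasure_expMeasure hΩ
  unfold sqGainLaw
  infer_instance

/-- `P(a ≤ b, a + c ≤ t) = P(min a b + c ≤ t) / 2`, where `min a b + c` is distributed as the
maximum of two independent exponential variables. -/
lemma sqGainLaw_le_and_add_le {Ω : ℝ} (hΩ : 0 < Ω) {t : ℝ} (ht : 0 ≤ t) :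
    sqGainLaw Ω {p | p.1 ≤ p.2.1 ∧ p.1 + p.2.2 ≤ t} =
      ENNReal.ofReal ((1 - Real.exp (-(Ω * t))) ^ 2 / 2) := by
  have := isProbabilityMeasure_expMeasure hΩ
  have hm : MeasurableSet {p : ℝ × ℝ × ℝ | p.1 ≤ p.2.1 ∧ p.1 + p.2.2 ≤ t} := by
    rw [ofPred_and]
    exact (measurableSet_le (by fun_prop) (by fun_prop)).inter
      (measurableSet_le (by fun_prop) (by fun_prop))
  have hmeas : Measurable fun a => (expMeasure Ω).prod (expMeasure Ω)
      (Prod.mk a ⁻¹' {p : ℝ × ℝ × ℝ | p.1 ≤ p.2.1 ∧ p.1 + p.2.2 ≤ t}) :=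
    measurable_measure_prodMk_left hm
  rw [sqGainLaw, Measure.prod_apply hm, lintegral_expMeasure Ω hmeas]
  have hset (a : ℝ) : Prod.mk a ⁻¹' {p : ℝ × ℝ × ℝ | p.1 ≤ p.2.1 ∧ p.1 + p.2.2 ≤ t}
      = Ici a ×ˢ Iic (t - a) := by
    ext ⟨b, c⟩
    simp [add_comm a c, le_sub_iff_add_le]
  simp_rw [hset, Measure.prod_prod]
  rw [← Ioc_union_Ioi_eq_Ioi ht, lintegral_union measurableSet_Ioi (Ioc_disjoint_Ioi le_rfl)]
  have h0 : ∀ a ∈ Ioi t, ENNReal.ofReal (Ω * Real.exp (-(Ω * a))) *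
      (expMeasure Ω (Ici a) * expMeasure Ω (Iic (t - a))) = 0 := by
    intro a ha
    have : expMeasure Ω (Iic (t - a)) = 0 := by
      refine measure_mono_null (fun x hx => ?_) (ae_iff.1 (ae_pos_expMeasure Ω))
      simp only [mem_Ioi, mem_Iic, mem_ofPred_eq] at *
      linarith
    simp [this]
  have h1 : ∀ a ∈ Ioc 0 t, ENNReal.ofReal (Ω * Real.exp (-(Ω * a))) *
      (expMeasure Ω (Ici a) * expMeasure Ω (Iic (t - a))) =
      ENNReal.ofReal (Ω * Real.exp (-(2 * Ω * a)) - Ω * Real.exp (-(Ω * t)) *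
        Real.exp (-(Ω * a))) := by
    intro a ha
    rw [expMeasure_Ici hΩ ha.1.le, expMeasure_Iic hΩ (sub_nonneg.2 ha.2),
      ← ENNReal.ofReal_mul (by positivity), ← ENNReal.ofReal_mul (by positivity)]
    congr 1
    have e1 : Real.exp (-(2 * Ω * a)) = Real.exp (-(Ω * a)) * Real.exp (-(Ω * a)) := by
      rw [← Real.exp_add]; ring_nf
    have e2 : Real.exp (-(Ω * t)) = Real.exp (-(Ω * a)) * Real.exp (-(Ω * (t - a))) := by
      rw [← Real.exp_add]; ring_nf
    rw [e1, e2]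
    ring
  rw [setLIntegral_congr_fun measurableSet_Ioi h0, lintegral_zero, add_zero,
    setLIntegral_congr_fun measurableSet_Ioc h1]
  have hcont : Continuous fun a => Ω * Real.exp (-(2 * Ω * a)) - Ω * Real.exp (-(Ω * t)) *
        Real.exp (-(Ω * a)) := by fun_prop
  rw [← ofReal_integral_eq_lintegral_ofReal (hcont.integrableOn_Ioc)]
  · rw [← intervalIntegral.integral_of_le ht,
      intervalIntegral.integral_eq_sub_of_hasDerivAt
        (f := fun a => -(Real.exp (-(2 * Ω * a)) / 2) + Real.exp (-(Ω * t)) * Real.exp (-(Ω * a)))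
        _ (hcont.intervalIntegrable _ _)]
    · congr 1
      have e1 : Real.exp (-(2 * Ω * t)) = Real.exp (-(Ω * t)) * Real.exp (-(Ω * t)) := by
        rw [← Real.exp_add]; ring_nf
      rw [e1]
      simp only [mul_zero, neg_zero, Real.exp_zero]
      ring
    · intro a _
      have d1 : HasDerivAt (fun a => Real.exp (-(2 * Ω * a))) _ a :=
        (((hasDerivAt_id a).const_mul (2 * Ω)).neg).exp
      have d2 : HasDerivAt (fun a => Real.exp (-(Ω * a))) _ a :=
        (((hasDerivAt_id a).const_mul Ω).neg).exp
      refine ((d1.div_const 2).neg.add (d2.const_mul (Real.exp (-(Ω * t))))).congr_deriv ?_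
      simp only [id, Pi.neg_apply]
      ring
  · filter_upwards [self_mem_ae_restrict measurableSet_Ioc] with a ha
    simp only [Pi.zero_apply, sub_nonneg, mul_assoc]
    rw [← Real.exp_add]
    gcongr
    nlinarith [ha.2]

lemma lintegral_mul_exp_neg_mul_Ioi {k : ℝ} (hk : 0 < k) :
    ∫⁻ x in Ioi (0 : ℝ), ENNReal.ofReal (x * Real.exp (-(k * x))) = ENNReal.ofReal (1 / k ^ 2) := by
  have h := Real.integral_rpow_mul_exp_neg_mul_Ioi (a := 2) (r := k) (by norm_num) hk
  have hi := integrableOn_rpow_mul_exp_neg_mul_rpow (s := 1) (p := 1) (b := k) (by norm_num)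
    one_pos hk
  norm_num at h hi
  rw [← ofReal_integral_eq_lintegral_ofReal hi, h]
  · simp
  · filter_upwards [self_mem_ae_restrict measurableSet_Ioi] with x hx
    have := mem_Ioi.1 hx
    positivity

lemma hasDerivAt_mobius (b y : ℝ) (hy : 1 + y ≠ 0) :
    HasDerivAt (fun y => b * ((1 - y) / (1 + y))) (-(2 * b / (1 + y) ^ 2)) y := by
  have h := (((hasDerivAt_id y).const_sub 1).div ((hasDerivAt_id y).const_add 1) hy).const_mul b
  refine h.congr_deriv ?_
  simp only [id]
  field_simp
  ring

/-- The substitution `c = b (1 - y) / (1 + y)`, that is `y = (b - c) / (b + c)`. -/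
lemma lintegral_Ioi_eq_lintegral_mobius {b : ℝ} (hb : 0 < b) (f : ℝ → ℝ≥0∞) :
    ∫⁻ c in Ioi 0, f c =
      ∫⁻ y in Ioo (-1) 1, ENNReal.ofReal (2 * b / (1 + y) ^ 2) * f (b * ((1 - y) / (1 + y))) := by
  have himg : (fun y : ℝ => b * ((1 - y) / (1 + y))) '' Ioo (-1) 1 = Ioi 0 := by
    ext c
    simp only [mem_image, mem_Ioo, mem_Ioi]
    constructor
    · rintro ⟨y, ⟨h1, h2⟩, rfl⟩
      have : 0 < 1 - y := by linarith
      have : 0 < 1 + y := by linarith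
      positivity
    · intro hc
      refine ⟨(b - c) / (b + c), ⟨?_, ?_⟩, ?_⟩
      · rw [lt_div_iff₀ (by linarith)]; linarith
      · rw [div_lt_iff₀ (by linarith)]; linarith
      · have : b + c ≠ 0 := by positivity
        have h2 : 1 + (b - c) / (b + c) = 2 * b / (b + c) := by field_simp; ring
        have h3 : 1 - (b - c) / (b + c) = 2 * c / (b + c) := by field_simp; ring
        rw [h2, h3]
        field_simp
  rw [← himg, lintegral_image_eq_lintegral_abs_deriv_mul measurableSet_Ioo
    (f' := fun y => -(2 * b / (1 + y) ^ 2))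
    (fun y hy => (hasDerivAt_mobius b y (by linarith [hy.1])).hasDerivWithinAt)]
  · refine lintegral_congr fun y => ?_
    rw [abs_neg, abs_of_nonneg (by positivity)]
  · intro x hx y hy h
    have h1 : 1 + x ≠ 0 := by linarith [hx.1]
    have h2 : 1 + y ≠ 0 := by linarith [hy.1]
    have h := mul_left_cancel₀ hb.ne' h
    rw [div_eq_div_iff h1 h2] at h
    linarith

lemma lintegral_Ioo_pow_two_mul (n : ℕ) :
    ∫⁻ y in Ioo (-1 : ℝ) 1, ENNReal.ofReal (y ^ (2 * n)) = ENNReal.ofReal (2 / (2 * n + 1)) := by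
  have hnn (y : ℝ) : 0 ≤ y ^ (2 * n) := by rw [pow_mul]; positivity
  rw [← ofReal_integral_eq_lintegral_ofReal, ← integral_Ioc_eq_integral_Ioo,
    ← intervalIntegral.integral_of_le (by norm_num), integral_pow]
  · rw [Odd.neg_pow ⟨n, rfl⟩]
    norm_num
  · exact ((continuous_pow _).integrableOn_Icc).mono_set Ioo_subset_Icc_self
  · filter_upwards with y using hnn y

lemma hasSum_add_one_mul_geometric {x : ℝ} (hx0 : 0 ≤ x) (hx : x < 1) :
    HasSum (fun n : ℕ => (n + 1) * x ^ n) (1 / (1 - x) ^ 2) := by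
  have := hasSum_choose_mul_geometric_of_norm_lt_one 1 (r := x) (by rwa [Real.norm_of_nonneg hx0])
  simpa using this

/-- The Laplace transform of half the harmonic mean of two independent exponential variables. -/
lemma lintegral_exp_neg_harmonic {Ω s : ℝ} (hΩ : 0 < Ω) (hs : 0 < s) :
    ∫⁻ b, ∫⁻ c, ENNReal.ofReal (Real.exp (-(s * (b * c / (b + c))))) ∂expMeasure Ω ∂expMeasure Ω =
      ENNReal.ofReal (√Real.pi * Ω ^ 2 *
        (32 * Ω / (Real.Gamma 2.5 * (4 * Ω + s) ^ 3)
            * ordinaryHypergeometric (3 : ℝ) 1.5 2.5 (s / (4 * Ω + s))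
          + 4 / (Real.Gamma 2.5 * (4 * Ω + s) ^ 2)
            * ordinaryHypergeometric (2 : ℝ) 0.5 2.5 (s / (4 * Ω + s)))) := by
  have := isProbabilityMeasure_expMeasure hΩ
  rw [lintegral_expMeasure Ω (Measurable.lintegral_prod_right (by fun_prop))]
  set κ : ℝ → ℝ := fun y => 2 / (1 + y) * (Ω + s * (1 - y ^ 2) / 4) with hκ
  have hκpos {y : ℝ} (hy : y ∈ Ioo (-1 : ℝ) 1) : 0 < κ y := by
    have h1 : 0 < 1 + y := by linarith [hy.1]
    have h2 : 0 ≤ 1 - y ^ 2 := by nlinarith [hy.1, hy.2]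
    positivity
  -- In terms of `y = (b - c) / (b + c)` the joint density is a gamma density in `b`.
  have h1 : ∀ b ∈ Ioi (0 : ℝ), ENNReal.ofReal (Ω * Real.exp (-(Ω * b))) *
      ∫⁻ c, ENNReal.ofReal (Real.exp (-(s * (b * c / (b + c))))) ∂expMeasure Ω =
      ∫⁻ y in Ioo (-1) 1, ENNReal.ofReal (2 * Ω ^ 2 / (1 + y) ^ 2) *
        ENNReal.ofReal (b * Real.exp (-(κ y * b))) := by
    intro b hb
    have hb : 0 < b := hb
    rw [lintegral_expMeasure Ω (by fun_prop), lintegral_Ioi_eq_lintegral_mobius hb,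
      ← lintegral_const_mul _ (by fun_prop)]
    refine setLIntegral_congr_fun measurableSet_Ioo fun y hy => ?_
    have h1 : 0 < 1 + y := by linarith [hy.1]
    rw [← ENNReal.ofReal_mul (by positivity), ← ENNReal.ofReal_mul (by positivity),
      ← ENNReal.ofReal_mul (by positivity), ← ENNReal.ofReal_mul (by positivity)]
    congr 1
    have he : Real.exp (-(κ y * b)) = Real.exp (-(Ω * b)) *
        (Real.exp (-(Ω * (b * ((1 - y) / (1 + y))))) *
          Real.exp (-(s * (b * (b * ((1 - y) / (1 + y))) / (b + b * ((1 - y) / (1 + y))))))) := by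
      rw [← Real.exp_add, ← Real.exp_add]
      congr 1
      have h2 : b + b * ((1 - y) / (1 + y)) = 2 * b / (1 + y) := by field_simp; ring
      rw [h2, hκ]
      field_simp
      ring
    rw [he]
    ring
  rw [setLIntegral_congr_fun measurableSet_Ioi h1, lintegral_lintegral_swap (by fun_prop)]
  set q := s / (4 * Ω + s) with hq
  have hq0 : 0 < q := by positivity
  have hq1 : q < 1 := by rw [hq, div_lt_one (by positivity)]; linarith
  have hS := hasSum_hypergeometric_bound hΩ hs
  have h2 : ∀ y ∈ Ioo (-1 : ℝ) 1, ∫⁻ b in Ioi 0, ENNReal.ofReal (2 * Ω ^ 2 / (1 + y) ^ 2) *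
        ENNReal.ofReal (b * Real.exp (-(κ y * b))) =
      ∑' n : ℕ, ENNReal.ofReal (8 * Ω ^ 2 / (4 * Ω + s) ^ 2 * (n + 1) * q ^ n) *
        ENNReal.ofReal (y ^ (2 * n)) := by
    intro y hy
    have h1 : 0 < 1 + y := by linarith [hy.1]
    have hy2 : 0 ≤ y ^ 2 := sq_nonneg y
    have hy1 : y ^ 2 < 1 := by nlinarith [hy.1, hy.2]
    rw [lintegral_const_mul _ (by fun_prop), lintegral_mul_exp_neg_mul_Ioi (hκpos hy),
      ← ENNReal.ofReal_mul (by positivity)]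
    have hsum := (hasSum_add_one_mul_geometric (x := q * y ^ 2) (by positivity)
      (by nlinarith)).mul_left (8 * Ω ^ 2 / (4 * Ω + s) ^ 2)
    have hterm (n : ℕ) : ENNReal.ofReal (8 * Ω ^ 2 / (4 * Ω + s) ^ 2 * (n + 1) * q ^ n) *
        ENNReal.ofReal (y ^ (2 * n)) =
        ENNReal.ofReal (8 * Ω ^ 2 / (4 * Ω + s) ^ 2 * ((n + 1) * (q * y ^ 2) ^ n)) := by
      rw [← ENNReal.ofReal_mul (by positivity)]
      ring_nf
    simp_rw [hterm]
    rw [← ENNReal.ofReal_tsum_of_nonneg (fun n => by positivity) hsum.summable, hsum.tsum_eq]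
    congr 1
    have hd : 0 < Ω + s * (1 - y ^ 2) / 4 := by nlinarith
    have hqy : 1 - q * y ^ 2 = 4 * (Ω + s * (1 - y ^ 2) / 4) / (4 * Ω + s) := by
      rw [hq]; field_simp; ring
    rw [hqy, hκ]
    field_simp
    ring
  rw [setLIntegral_congr_fun measurableSet_Ioo h2, lintegral_tsum (fun n => by fun_prop),
    ← hS.tsum_eq, ENNReal.ofReal_tsum_of_nonneg (fun n => by positivity) hS.summable]
  refine tsum_congr fun n => ?_
  rw [lintegral_const_mul _ (by fun_prop), lintegral_Ioo_pow_two_mul,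
    ← ENNReal.ofReal_mul (by positivity)]
  congr 1
  field_simp
  ring

/-! ### The tail of the Gaussian law -/

/-- The error probability `Q(√(2 x))` of coherent BPSK at signal to noise ratio `x`, where `Q` is
the tail of the standard Gaussian law. -/
noncomputable def gaussianTail (x : ℝ) : ℝ≥0∞ := gaussianReal 0 1 (Ici √(2 * x))

lemma gaussianReal_singleton (m : ℝ) {v : NNReal} (hv : v ≠ 0) (x : ℝ) :
    gaussianReal m v {x} = 0 :=
  gaussianReal_absolutelyContinuous m hv (by simp)

lemma gaussianReal_Ioi {v : NNReal} (hv : v ≠ 0) (x : ℝ) :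
    gaussianReal 0 v (Ioi x) = gaussianReal 0 v (Ici x) := by
  rw [← Ioi_union_left, measure_union (by simp) (by simp), gaussianReal_singleton 0 hv, add_zero]

lemma gaussianReal_Iio_neg {v : NNReal} (hv : v ≠ 0) (x : ℝ) :
    gaussianReal 0 v (Iio (-x)) = gaussianReal 0 v (Ici x) := by
  have h : (gaussianReal 0 v).map (fun x => -x) = gaussianReal 0 v := by
    rw [gaussianReal_map_neg, neg_zero]
  rw [← gaussianReal_Ioi hv, ← h, Measure.map_apply (by fun_prop) measurableSet_Iio, h]
  congr 1
  ext y
  simp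

lemma gaussianReal_Ici_zero : gaussianReal 0 1 (Ici 0) = ENNReal.ofReal (1 / 2) := by
  have h1 : gaussianReal 0 1 (Iio 0) = gaussianReal 0 1 (Ici 0) := by
    simpa using gaussianReal_Iio_neg one_ne_zero 0
  have h2 := prob_add_prob_compl (μ := gaussianReal 0 1) (measurableSet_Ici (a := (0 : ℝ)))
  rw [compl_Ici, h1, ← two_mul] at h2
  rw [one_div, ENNReal.ofReal_inv_of_pos two_pos, ENNReal.ofReal_ofNat]
  exact ENNReal.eq_inv_of_mul_eq_one_left (by rwa [mul_comm])

/-- The Chernoff bound with the sharp constant `1 / 2`, obtained by shifting the tail to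
`[0, ∞)`. -/
lemma gaussianTail_le {x : ℝ} (hx : 0 ≤ x) :
    gaussianTail x ≤ ENNReal.ofReal (Real.exp (-x)) * ENNReal.ofReal (1 / 2) := by
  set y := √(2 * x) with hy
  have hy0 : 0 ≤ y := Real.sqrt_nonneg _
  have hy2 : y ^ 2 = 2 * x := Real.sq_sqrt (by positivity)
  have hmap : gaussianReal 0 1 (Ici y) = gaussianReal (-y) 1 (Ici 0) := by
    rw [← zero_sub y, ← gaussianReal_map_sub_const, Measure.map_apply (by fun_prop)
      measurableSet_Ici]
    congr 1
    ext z
    simp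
  rw [gaussianTail, hmap, gaussianReal_apply _ one_ne_zero, ← gaussianReal_Ici_zero,
    gaussianReal_apply _ one_ne_zero, ← lintegral_const_mul _ (by fun_prop)]
  refine setLIntegral_mono (by fun_prop) fun z hz => ?_
  have hz : 0 ≤ z := hz
  rw [gaussianPDF, gaussianPDF, ← ENNReal.ofReal_mul (by positivity)]
  refine ENNReal.ofReal_le_ofReal ?_
  simp only [gaussianPDFReal, NNReal.coe_one, mul_one]
  rw [mul_left_comm, ← Real.exp_add]
  gcongr
  nlinarith [mul_nonneg hz hy0]

lemma gaussianReal_Ici_eq_gaussianTail {v : NNReal} (hv : v ≠ 0) {t : ℝ} (ht : 0 ≤ t) :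
    gaussianReal 0 v (Ici t) = gaussianTail (t ^ 2 / (2 * v)) := by
  have hv0 : (0 : ℝ) < v := by positivity
  have hmap : gaussianReal 0 v = (gaussianReal 0 1).map (√(v : ℝ) * ·) := by
    rw [gaussianReal_map_const_mul]
    congr 1
    · simp
    · rw [mul_one]; ext; simp
  rw [hmap, Measure.map_apply (by fun_prop) measurableSet_Ici, gaussianTail]
  congr 1
  ext z
  have h1 : 2 * (t ^ 2 / (2 * v)) = (t / √(v : ℝ)) ^ 2 := by
    rw [div_pow, Real.sq_sqrt hv0.le]; field_simp
  rw [h1, Real.sqrt_sq (by positivity)]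
  simp only [mem_preimage, mem_Ici]
  rw [div_le_iff₀ (by positivity), mul_comm]

lemma measurable_gaussianTail : Measurable gaussianTail := by
  have : Antitone gaussianTail := fun x y h =>
    measure_mono (Ici_subset_Ici.2 (Real.sqrt_le_sqrt (by linarith)))
  exact this.measurable

/-- The average over the positive values of a standard Gaussian `z` of the probability in
`sqGainLaw_le_and_add_le`, at `Ω t = k z²`. -/
lemma setLIntegral_gaussianReal_exp {k : ℝ} (hk : 0 ≤ k) :
    ∫⁻ z in Ici 0, ENNReal.ofReal ((1 - Real.exp (-(k * z ^ 2))) ^ 2 / 2) ∂gaussianReal 0 1 =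
      ENNReal.ofReal (1 / 4 * (1 - 2 * √(1 / (1 + 2 * k)) + √(1 / (1 + 4 * k)))) := by
  have e1 (z : ℝ) : Real.exp (-(1 / 2 + k) * z ^ 2)
      = Real.exp (-(1 / 2) * z ^ 2) * Real.exp (-(k * z ^ 2)) := by
    rw [← Real.exp_add]; ring_nf
  have e2 (z : ℝ) : Real.exp (-(1 / 2 + 2 * k) * z ^ 2)
      = Real.exp (-(1 / 2) * z ^ 2) * Real.exp (-(k * z ^ 2)) * Real.exp (-(k * z ^ 2)) := by
    rw [← Real.exp_add, ← Real.exp_add]; ring_nf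
  rw [gaussianReal_of_var_ne_zero _ one_ne_zero, restrict_withDensity measurableSet_Ici,
    lintegral_withDensity_eq_lintegral_mul _ (by fun_prop) (by fun_prop),
    setLIntegral_congr Ioi_ae_eq_Ici.symm]
  have hfun (z : ℝ) : (gaussianPDF 0 1 * fun z => ENNReal.ofReal
      ((1 - Real.exp (-(k * z ^ 2))) ^ 2 / 2)) z = ENNReal.ofReal ((√(2 * Real.pi))⁻¹ / 2 *
        (Real.exp (-(1 / 2) * z ^ 2) - 2 * Real.exp (-(1 / 2 + k) * z ^ 2)
          + Real.exp (-(1 / 2 + 2 * k) * z ^ 2))) := by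
    simp only [Pi.mul_apply, gaussianPDF, gaussianPDFReal, NNReal.coe_one, mul_one, sub_zero]
    rw [← ENNReal.ofReal_mul (by positivity)]
    congr 1
    have e0 : Real.exp (-z ^ 2 / 2) = Real.exp (-(1 / 2) * z ^ 2) := by ring_nf
    rw [e0, e1, e2]
    ring
  simp_rw [hfun]
  have i0 : IntegrableOn (fun z : ℝ => Real.exp (-(1 / 2) * z ^ 2)) (Ioi 0) :=
    (integrable_exp_neg_mul_sq (by norm_num)).integrableOn
  have i1 : IntegrableOn (fun z : ℝ => Real.exp (-(1 / 2 + k) * z ^ 2)) (Ioi 0) :=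
    (integrable_exp_neg_mul_sq (by positivity)).integrableOn
  have i2 : IntegrableOn (fun z : ℝ => Real.exp (-(1 / 2 + 2 * k) * z ^ 2)) (Ioi 0) :=
    (integrable_exp_neg_mul_sq (by positivity)).integrableOn
  have i01 : IntegrableOn (fun z : ℝ => Real.exp (-(1 / 2) * z ^ 2)
      - 2 * Real.exp (-(1 / 2 + k) * z ^ 2)) (Ioi 0) := i0.sub (i1.const_mul 2)
  rw [← ofReal_integral_eq_lintegral_ofReal]
  · rw [integral_const_mul, integral_add i01 i2,
      integral_sub i0 (i1.const_mul 2), integral_const_mul, integral_gaussian_Ioi,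
      integral_gaussian_Ioi, integral_gaussian_Ioi]
    congr 1
    have hb {b : ℝ} (hb : 0 ≤ b) : √(Real.pi / (1 / 2 + b)) =
        √(2 * Real.pi) * √(1 / (1 + 2 * b)) := by
      rw [← Real.sqrt_mul (by positivity)]
      congr 1
      field_simp
    have h0 : √(Real.pi / (1 / 2)) = √(2 * Real.pi) := by congr 1; ring
    have hpi : √(2 * Real.pi) ≠ 0 := by positivity
    rw [hb hk, hb (by positivity : 0 ≤ 2 * k), h0, ← mul_assoc 2 2 k]
    norm_num only
    field_simp
    ring
  · exact (i01.add i2).const_mul _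
  · filter_upwards with z
    simp only [Pi.zero_apply]
    have : Real.exp (-(1 / 2) * z ^ 2) - 2 * Real.exp (-(1 / 2 + k) * z ^ 2)
          + Real.exp (-(1 / 2 + 2 * k) * z ^ 2) =
        Real.exp (-(1 / 2) * z ^ 2) * (1 - Real.exp (-(k * z ^ 2))) ^ 2 := by
      rw [e1, e2]; ring
    rw [this]
    positivity

/-! ### Averages over the squared gains -/

lemma lintegral_sqGainLaw {Ω : ℝ} (hΩ : 0 < Ω) {f : ℝ × ℝ × ℝ → ℝ≥0∞} (hf : Measurable f) :
    ∫⁻ p, f p ∂sqGainLaw Ω =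
      ∫⁻ a, ∫⁻ b, ∫⁻ c, f (a, b, c) ∂expMeasure Ω ∂expMeasure Ω ∂expMeasure Ω := by
  have := isProbabilityMeasure_expMeasure hΩ
  rw [sqGainLaw, lintegral_prod _ hf.aemeasurable]
  refine lintegral_congr fun a => ?_
  rw [lintegral_prod _ (by fun_prop)]

lemma ae_pos_sqGainLaw {Ω : ℝ} (hΩ : 0 < Ω) :
    ∀ᵐ p ∂sqGainLaw Ω, 0 < p.1 ∧ 0 < p.2.1 ∧ 0 < p.2.2 := by
  have := isProbabilityMeasure_expMeasure hΩ
  have h := ae_pos_expMeasure Ω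
  have h1 : ∀ᵐ p ∂sqGainLaw Ω, 0 < p.1 := Measure.quasiMeasurePreserving_fst.ae h
  have h2 : ∀ᵐ p ∂sqGainLaw Ω, 0 < p.2.1 :=
    Measure.quasiMeasurePreserving_snd.ae (Measure.quasiMeasurePreserving_fst.ae h)
  have h3 : ∀ᵐ p ∂sqGainLaw Ω, 0 < p.2.2 :=
    Measure.quasiMeasurePreserving_snd.ae (Measure.quasiMeasurePreserving_snd.ae h)
  filter_upwards [h1, h2, h3] with p h1 h2 h3 using ⟨h1, h2, h3⟩

/-- Average error probability of coherent detection from the direct transmission. -/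
lemma lintegral_gaussianTail_direct_le {Ω s : ℝ} (hΩ : 0 < Ω) (hs : 0 < s) :
    ∫⁻ p, gaussianTail (s * p.1) ∂sqGainLaw Ω ≤ ENNReal.ofReal (1 / 2 * (Ω / (s + Ω))) := by
  have := isProbabilityMeasure_expMeasure hΩ
  calc ∫⁻ p, gaussianTail (s * p.1) ∂sqGainLaw Ω
      ≤ ∫⁻ p, ENNReal.ofReal (Real.exp (-(s * p.1))) * ENNReal.ofReal (1 / 2) ∂sqGainLaw Ω := by
        refine lintegral_mono_ae ?_
        filter_upwards [ae_pos_sqGainLaw hΩ] with p hp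
        exact gaussianTail_le (mul_nonneg hs.le hp.1.le)
    _ = ENNReal.ofReal (1 / 2 * (Ω / (s + Ω))) := by
        rw [lintegral_mul_const _ (by fun_prop), lintegral_sqGainLaw hΩ (by fun_prop)]
        simp only [lintegral_const, measure_univ, mul_one]
        rw [lintegral_exp_neg_expMeasure hΩ hs.le, ← ENNReal.ofReal_mul (by positivity)]
        ring_nf

lemma lintegral_exp_neg_add {Ω s : ℝ} (hΩ : 0 < Ω) (hs : 0 < s) (f : ℝ → ℝ → ℝ)
    (hf : Measurable f.uncurry) :
    ∫⁻ p, ENNReal.ofReal (Real.exp (-(s * (p.1 + f p.2.1 p.2.2)))) ∂sqGainLaw Ω =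
      ENNReal.ofReal (Ω / (Ω + s)) *
        ∫⁻ b, ∫⁻ c, ENNReal.ofReal (Real.exp (-(s * f b c))) ∂expMeasure Ω ∂expMeasure Ω := by
  have := isProbabilityMeasure_expMeasure hΩ
  have hf' : Measurable fun p : ℝ × ℝ × ℝ => f p.2.1 p.2.2 := hf.comp measurable_snd
  have hf2 : Measurable fun p : ℝ × ℝ => f p.1 p.2 := hf
  rw [lintegral_sqGainLaw hΩ (by fun_prop), ← lintegral_exp_neg_expMeasure hΩ hs.le,
    ← lintegral_mul_const _ (by fun_prop)]
  refine lintegral_congr fun a => ?_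
  rw [← lintegral_const_mul _ (Measurable.lintegral_prod_right (by fun_prop))]
  refine lintegral_congr fun b => ?_
  rw [← lintegral_const_mul _ (by fun_prop)]
  refine lintegral_congr fun c => ?_
  rw [← ENNReal.ofReal_mul (by positivity), ← Real.exp_add]
  ring_nf

/-- Average error probability of maximum ratio combining of the direct and relay receptions. -/
lemma lintegral_gaussianTail_mrc_le {Ω s : ℝ} (hΩ : 0 < Ω) (hs : 0 < s) :
    ∫⁻ p, gaussianTail (s * (p.1 + p.2.2)) ∂sqGainLaw Ω ≤
      ENNReal.ofReal (1 / 2 * (Ω / (s + Ω)) ^ 2) := by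
  have := isProbabilityMeasure_expMeasure hΩ
  calc ∫⁻ p, gaussianTail (s * (p.1 + p.2.2)) ∂sqGainLaw Ω
      ≤ ∫⁻ p, ENNReal.ofReal (Real.exp (-(s * (p.1 + p.2.2)))) * ENNReal.ofReal (1 / 2)
          ∂sqGainLaw Ω := by
        refine lintegral_mono_ae ?_
        filter_upwards [ae_pos_sqGainLaw hΩ] with p hp
        exact gaussianTail_le (mul_nonneg hs.le (add_pos hp.1 hp.2.2).le)
    _ = ENNReal.ofReal (1 / 2 * (Ω / (s + Ω)) ^ 2) := by
        rw [lintegral_mul_const _ (by fun_prop),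
          lintegral_exp_neg_add hΩ hs (fun _ c => c) measurable_snd]
        simp only [lintegral_const, measure_univ, mul_one]
        rw [lintegral_exp_neg_expMeasure hΩ hs.le, ← ENNReal.ofReal_mul (by positivity),
          ← ENNReal.ofReal_mul (by positivity)]
        ring_nf

/-- Average error probability of the user detected second. The bound is that of maximum ratio
combining, halved, as if the error were independent of the order of detection. It is false with the
Chernoff bound in place of the Gaussian tail, as the user detected second is the one with the
smaller direct gain; the exact average is needed. -/
lemma lintegral_gaussianTail_second_le {Ω s : ℝ} (hΩ : 0 < Ω) (hs : 0 < s) :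
    ∫⁻ p in {p | p.1 ≤ p.2.1}, gaussianTail (s * (p.1 + p.2.2)) ∂sqGainLaw Ω ≤
      ENNReal.ofReal (1 / 4 * (Ω / (Ω + s)) ^ 2) := by
  have := isProbabilityMeasure_sqGainLaw hΩ
  -- Write the tail as the probability of an event in `z` and integrate over the gains first.
  set S : Set ((ℝ × ℝ × ℝ) × ℝ) :=
    {x | x.1.1 ≤ x.1.2.1 ∧ √(2 * (s * (x.1.1 + x.1.2.2))) ≤ x.2} with hSdef
  have hS : MeasurableSet S := by
    rw [hSdef, ofPred_and]
    exact (measurableSet_le (by fun_prop) (by fun_prop)).inter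
      (measurableSet_le (by fun_prop) (by fun_prop))
  have hle : MeasurableSet {p : ℝ × ℝ × ℝ | p.1 ≤ p.2.1} :=
    measurableSet_le (by fun_prop) (by fun_prop)
  have h1 : ∫⁻ p in {p | p.1 ≤ p.2.1}, gaussianTail (s * (p.1 + p.2.2)) ∂sqGainLaw Ω
      = ((sqGainLaw Ω).prod (gaussianReal 0 1)) S := by
    rw [Measure.prod_apply hS, ← lintegral_indicator hle]
    refine lintegral_congr fun p => ?_
    by_cases hp : p.1 ≤ p.2.1
    · rw [indicator_of_mem (by exact hp), gaussianTail]
      congr 1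
      ext z
      simp [hSdef, hp]
    · rw [indicator_of_notMem (by exact hp)]
      have : Prod.mk p ⁻¹' S = ∅ := by
        ext z
        simp [hSdef, hp]
      simp [this]
  have h2 : ∀ z : ℝ, sqGainLaw Ω ((fun p => (p, z)) ⁻¹' S) =
      (Ici (0 : ℝ)).indicator (fun z => ENNReal.ofReal
        ((1 - Real.exp (-(Ω / (2 * s) * z ^ 2))) ^ 2 / 2)) z := by
    intro z
    by_cases hz : 0 ≤ z
    · rw [indicator_of_mem (by exact hz), mul_comm_div, ← mul_div_assoc, mul_div_assoc Ω,
        ← sqGainLaw_le_and_add_le hΩ (by positivity)]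
      congr 1
      ext p
      simp only [hSdef, mem_preimage, mem_ofPred_eq, Real.sqrt_le_iff, hz, true_and]
      rw [le_div_iff₀ (by positivity)]
      constructor <;> rintro ⟨h, h'⟩ <;> exact ⟨h, by linarith⟩
    · rw [indicator_of_notMem (by exact hz)]
      have : (fun p => (p, z)) ⁻¹' S = ∅ := by
        ext p
        simp only [hSdef, mem_preimage, mem_ofPred_eq, Real.sqrt_le_iff, hz, false_and, and_false,
          mem_empty_iff_false]
      simp [this]
  rw [h1, Measure.prod_apply_symm hS]
  simp_rw [h2]
  rw [lintegral_indicator measurableSet_Ici, setLIntegral_gaussianReal_exp (by positivity)]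
  refine ENNReal.ofReal_le_ofReal ?_
  have h3 := one_sub_two_mul_sqrt_add_sqrt_le (s := s / Ω) (by positivity)
  have e1 : s / Ω / (1 + s / Ω) = 1 / (1 + 2 * (Ω / (2 * s))) := by field_simp; ring
  have e2 : s / Ω / (2 + s / Ω) = 1 / (1 + 4 * (Ω / (2 * s))) := by field_simp; ring
  have e3 : 1 / (1 + s / Ω) = Ω / (Ω + s) := by field_simp
  rw [e1, e2, e3] at h3
  linarith

/-- The effective squared gain `a + b c / (b + c)` after nulling and maximum ratio combining, as a
function of the squared gains `(a, (b, c))`. -/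
noncomputable def nullingSqGain (p : ℝ × ℝ × ℝ) : ℝ := p.1 + p.2.1 * p.2.2 / (p.2.1 + p.2.2)

lemma measurable_nullingSqGain : Measurable nullingSqGain := by
  unfold nullingSqGain
  fun_prop

/-- The user with the larger direct gain has the larger signal to noise ratio after nulling. -/
lemma nullingSqGain_le_iff {a b c : ℝ} (ha : 0 < a) (hb : 0 < b) (hc : 0 < c) :
    nullingSqGain (b, a, c) ≤ nullingSqGain (a, b, c) ↔ b ≤ a := by
  have h : nullingSqGain (a, b, c) - nullingSqGain (b, a, c) =
      (a - b) * ((a * b + a * c + b * c) / ((a + c) * (b + c))) := by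
    simp only [nullingSqGain]
    field_simp
    ring
  rw [← sub_nonneg, h, mul_nonneg_iff_of_pos_right (by positivity), sub_nonneg]

lemma measurePreserving_swap_sqGainLaw {Ω : ℝ} (hΩ : 0 < Ω) :
    MeasurePreserving (fun p : ℝ × ℝ × ℝ => (p.2.1, p.1, p.2.2)) (sqGainLaw Ω) (sqGainLaw Ω) := by
  have := isProbabilityMeasure_expMeasure hΩ
  refine ⟨by fun_prop, Measure.ext_of_lintegral _ fun f hf => ?_⟩
  rw [lintegral_map hf (by fun_prop), lintegral_sqGainLaw hΩ (by fun_prop),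
    lintegral_sqGainLaw hΩ hf, lintegral_lintegral_swap]
  exact (Measurable.lintegral_prod_right (by fun_prop)).aemeasurable

lemma sqGainLaw_tie {Ω : ℝ} (hΩ : 0 < Ω) : sqGainLaw Ω {p | p.1 = p.2.1} = 0 := by
  have := isProbabilityMeasure_expMeasure hΩ
  have hm : MeasurableSet {p : ℝ × ℝ × ℝ | p.1 = p.2.1} :=
    measurableSet_eq_fun (by fun_prop) (by fun_prop)
  rw [sqGainLaw, Measure.prod_apply hm]
  have (a : ℝ) : Prod.mk a ⁻¹' {p : ℝ × ℝ × ℝ | p.1 = p.2.1} = {a} ×ˢ univ := by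
    ext p
    simp [eq_comm]
  simp [this, Measure.prod_prod, noAtoms_expMeasure]

/-- Average error probability of the user detected first. That user maximises the signal to noise
ratio, so that the average over this event is at most half of the unconditional average. -/
lemma lintegral_gaussianTail_first_le {Ω s : ℝ} (hΩ : 0 < Ω) (hs : 0 < s) :
    ∫⁻ p in {p | p.2.1 ≤ p.1}, gaussianTail (s * nullingSqGain p) ∂sqGainLaw Ω ≤
      ENNReal.ofReal (1 / 4 * (Ω / (Ω + s) * (√Real.pi * Ω ^ 2 *
        (32 * Ω / (Real.Gamma 2.5 * (4 * Ω + s) ^ 3)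
            * ordinaryHypergeometric (3 : ℝ) 1.5 2.5 (s / (4 * Ω + s))
          + 4 / (Real.Gamma 2.5 * (4 * Ω + s) ^ 2)
            * ordinaryHypergeometric (2 : ℝ) 0.5 2.5 (s / (4 * Ω + s)))))) := by
  have := isProbabilityMeasure_sqGainLaw hΩ
  set g : ℝ × ℝ × ℝ → ℝ≥0∞ := fun p => ENNReal.ofReal (Real.exp (-(s * nullingSqGain p))) with hg
  have hgm : Measurable g := by
    have := measurable_nullingSqGain
    fun_prop
  set σ : ℝ × ℝ × ℝ → ℝ × ℝ × ℝ := fun p => (p.2.1, p.1, p.2.2)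
  have hσ : MeasurePreserving σ (sqGainLaw Ω) (sqGainLaw Ω) := measurePreserving_swap_sqGainLaw hΩ
  have hA : MeasurableSet {p : ℝ × ℝ × ℝ | p.2.1 ≤ p.1} :=
    measurableSet_le (by fun_prop) (by fun_prop)
  have hB : MeasurableSet {p : ℝ × ℝ × ℝ | p.1 ≤ p.2.1} :=
    measurableSet_le (by fun_prop) (by fun_prop)
  -- Exchange `a` and `b`, which can only decrease the signal to noise ratio on this event.
  have hle : ∫⁻ p in {p | p.2.1 ≤ p.1}, g p ∂sqGainLaw Ω ≤
      ∫⁻ p in {p | p.1 ≤ p.2.1}, g p ∂sqGainLaw Ω := by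
    rw [← hσ.setLIntegral_comp_preimage hB hgm]
    refine lintegral_mono_ae ?_
    filter_upwards [ae_restrict_mem hA, ae_restrict_of_ae (ae_pos_sqGainLaw hΩ)] with p hp h0
    refine ENNReal.ofReal_le_ofReal (Real.exp_le_exp.2 ?_)
    have := (nullingSqGain_le_iff h0.1 h0.2.1 h0.2.2).2 hp
    exact neg_le_neg (mul_le_mul_of_nonneg_left this hs.le)
  have htot : ∫⁻ p in {p | p.2.1 ≤ p.1}, g p ∂sqGainLaw Ω +
      ∫⁻ p in {p | p.1 ≤ p.2.1}, g p ∂sqGainLaw Ω = ∫⁻ p, g p ∂sqGainLaw Ω := by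
    refine Eq.trans (congrArg _ ?_) (lintegral_add_compl (μ := sqGainLaw Ω) g hA)
    refine setLIntegral_congr ?_
    have : ∀ᵐ p ∂sqGainLaw Ω, p.1 ≠ p.2.1 := by
      rw [ae_iff]; simpa using sqGainLaw_tie hΩ
    filter_upwards [this] with p hp
    refine propext ⟨fun h => ?_, fun h => ?_⟩
    · exact not_le.2 (lt_of_le_of_ne h hp)
    · exact (not_le.1 (show ¬ p.2.1 ≤ p.1 from h)).le
  have hhalf : ∫⁻ p in {p | p.2.1 ≤ p.1}, g p ∂sqGainLaw Ω ≤
      ENNReal.ofReal (1 / 2) * ∫⁻ p, g p ∂sqGainLaw Ω := by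
    have h2 : 2 * ∫⁻ p in {p | p.2.1 ≤ p.1}, g p ∂sqGainLaw Ω ≤ ∫⁻ p, g p ∂sqGainLaw Ω := by
      rw [two_mul, ← htot]
      gcongr
    have h12 : ENNReal.ofReal (1 / 2) * 2 = 1 := by
      rw [← ENNReal.ofReal_ofNat 2, ← ENNReal.ofReal_mul (by norm_num)]
      norm_num
    calc _ = ENNReal.ofReal (1 / 2) * (2 * ∫⁻ p in {p | p.2.1 ≤ p.1}, g p ∂sqGainLaw Ω) := by
          rw [← mul_assoc, h12, one_mul]
      _ ≤ _ := by gcongr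
  calc ∫⁻ p in {p | p.2.1 ≤ p.1}, gaussianTail (s * nullingSqGain p) ∂sqGainLaw Ω
      ≤ ∫⁻ p in {p | p.2.1 ≤ p.1}, g p * ENNReal.ofReal (1 / 2) ∂sqGainLaw Ω := by
        refine lintegral_mono_ae (ae_restrict_of_ae ?_)
        filter_upwards [ae_pos_sqGainLaw hΩ] with p hp
        refine gaussianTail_le (mul_nonneg hs.le ?_)
        have h1 := hp.1
        have h2 := hp.2.1
        have h3 := hp.2.2
        unfold nullingSqGain
        positivity
    _ = (∫⁻ p in {p | p.2.1 ≤ p.1}, g p ∂sqGainLaw Ω) * ENNReal.ofReal (1 / 2) :=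
        lintegral_mul_const _ hgm
    _ ≤ (ENNReal.ofReal (1 / 2) * ∫⁻ p, g p ∂sqGainLaw Ω) * ENNReal.ofReal (1 / 2) := by gcongr
    _ = _ := by
        rw [hg]
        simp only [nullingSqGain]
        rw [lintegral_exp_neg_add hΩ hs (fun b c => b * c / (b + c)) (by
            unfold Function.uncurry; fun_prop),
          lintegral_exp_neg_harmonic hΩ hs, mul_comm, ← ENNReal.ofReal_mul (by positivity),
          ← mul_assoc, ← ENNReal.ofReal_mul (by norm_num), ← ENNReal.ofReal_mul (by positivity)]
        congr 1
        ring

/-! ### Complex Gaussian variables -/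

lemma measurable_complex_mk : Measurable fun p : ℝ × ℝ => (⟨p.1, p.2⟩ : ℂ) :=
  Complex.measurableEquivRealProd.symm.measurable

instance isProbabilityMeasure_complexGaussian (v : ℝ) :
    IsProbabilityMeasure (complexGaussian v) :=
  Measure.isProbabilityMeasure_map measurable_complex_mk.aemeasurable

lemma lintegral_Ioi_comp_sq (f : ℝ → ℝ≥0∞) :
    ∫⁻ t in Ioi 0, f t = ∫⁻ r in Ioi 0, ENNReal.ofReal (2 * r) * f (r ^ 2) := by
  have himg : (fun r : ℝ => r ^ 2) '' Ioi 0 = Ioi 0 := by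
    ext t
    simp only [mem_image, mem_Ioi]
    constructor
    · rintro ⟨r, hr, rfl⟩
      positivity
    · intro ht
      exact ⟨√t, Real.sqrt_pos.2 ht, Real.sq_sqrt ht.le⟩
  conv_lhs => rw [← himg]
  rw [lintegral_image_eq_lintegral_abs_deriv_mul measurableSet_Ioi (f' := fun r => 2 * r)]
  · refine setLIntegral_congr_fun measurableSet_Ioi fun r hr => ?_
    have : (0 : ℝ) < r := hr
    rw [abs_of_pos (by positivity)]
  · intro r _
    simpa using (hasDerivAt_pow 2 r).hasDerivWithinAt
  · intro x hx y hy h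
    exact (pow_left_inj₀ (le_of_lt hx) (le_of_lt hy) two_ne_zero).1 h

/-- The squared modulus of a `CN(0, 1 / Ω)` variable is exponential of rate `Ω`. -/
lemma map_normSq_complexGaussian {Ω : ℝ} (hΩ : 0 < Ω) :
    (complexGaussian (1 / Ω)).map (fun h => ‖h‖ ^ 2) = expMeasure Ω := by
  refine Measure.ext_of_lintegral _ fun f hf => ?_
  have hv : (1 / Ω / 2).toNNReal ≠ 0 := by
    rw [ne_eq, Real.toNNReal_eq_zero, not_le]; positivity
  have hv' : ((1 / Ω / 2).toNNReal : ℝ) = 1 / Ω / 2 := Real.coe_toNNReal _ (by positivity)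
  have hfm : Measurable fun p : ℝ × ℝ => f (‖(⟨p.1, p.2⟩ : ℂ)‖ ^ 2) :=
    hf.comp ((measurable_norm.pow_const 2).comp measurable_complex_mk)
  rw [lintegral_map hf (by fun_prop), complexGaussian,
    lintegral_map (by fun_prop) measurable_complex_mk, gaussianReal_of_var_ne_zero _ hv,
    prod_withDensity (by fun_prop) (by fun_prop),
    lintegral_withDensity_eq_lintegral_mul _ (by fun_prop) hfm,
    ← Measure.volume_eq_prod, ← lintegral_comp_polarCoord_symm, polarCoord_target,
    Measure.volume_eq_prod, ← Measure.prod_restrict]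
  have hfun : ∀ p ∈ Ioi (0 : ℝ) ×ˢ Ioo (-Real.pi) Real.pi,
      ENNReal.ofReal p.1 • ((fun z : ℝ × ℝ => gaussianPDF 0 (1 / Ω / 2).toNNReal z.1 *
        gaussianPDF 0 (1 / Ω / 2).toNNReal z.2) * fun a : ℝ × ℝ => f (‖(⟨a.1, a.2⟩ : ℂ)‖ ^ 2))
        (polarCoord.symm p) =
      ENNReal.ofReal (Ω / Real.pi * p.1 * Real.exp (-(Ω * p.1 ^ 2))) * f (p.1 ^ 2) := by
    rintro ⟨r, θ⟩ ⟨hr, -⟩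
    have hr : 0 < r := hr
    have hsq : (r * Real.cos θ) ^ 2 + (r * Real.sin θ) ^ 2 = r ^ 2 := by
      rw [mul_pow, mul_pow, ← mul_add, Real.cos_sq_add_sin_sq, mul_one]
    have hn : ‖(⟨r * Real.cos θ, r * Real.sin θ⟩ : ℂ)‖ ^ 2 = r ^ 2 := by
      rw [← Complex.normSq_eq_norm_sq, Complex.normSq_mk, ← hsq]; ring
    simp only [polarCoord_symm_apply, Pi.mul_apply, hn, smul_eq_mul, gaussianPDF,
      gaussianPDFReal, hv', sub_zero]
    rw [← mul_assoc, ← ENNReal.ofReal_mul (by positivity), ← ENNReal.ofReal_mul (by positivity)]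
    congr 2
    have e : Real.exp (-(Ω * r ^ 2)) = Real.exp (-(r * Real.cos θ) ^ 2 / (2 * (1 / Ω / 2))) *
        Real.exp (-(r * Real.sin θ) ^ 2 / (2 * (1 / Ω / 2))) := by
      rw [← Real.exp_add, ← hsq]
      congr 1
      field_simp
      ring
    rw [e]
    have hs : (√(2 * Real.pi * (1 / Ω / 2)))⁻¹ * (√(2 * Real.pi * (1 / Ω / 2)))⁻¹
        = Ω / Real.pi := by
      rw [← mul_inv, Real.mul_self_sqrt (by positivity)]
      field_simp
    rw [← hs]
    ring
  rw [Measure.prod_restrict, setLIntegral_congr_fun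
    (measurableSet_Ioi.prod measurableSet_Ioo) hfun, ← Measure.prod_restrict,
    lintegral_prod _ (by fun_prop), lintegral_expMeasure Ω hf,
    lintegral_Ioi_comp_sq fun t => ENNReal.ofReal (Ω * Real.exp (-(Ω * t))) * f t]
  refine setLIntegral_congr_fun measurableSet_Ioi fun r hr => ?_
  have hr : 0 < r := hr
  simp only [lintegral_const, Measure.restrict_apply MeasurableSet.univ, univ_inter,
    Real.volume_Ioo]
  rw [mul_right_comm, ← mul_assoc, ← ENNReal.ofReal_mul (by positivity),
    ← ENNReal.ofReal_mul (by positivity)]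
  congr 2
  have := Real.pi_ne_zero
  field_simp
  ring

lemma map_add_prod_gaussianReal {α β : Type*} [MeasurableSpace α] [MeasurableSpace β]
    {μ : Measure α} {ν : Measure β} [IsProbabilityMeasure μ] [IsProbabilityMeasure ν]
    {f : α → ℝ} {g : β → ℝ} (hf : Measurable f) (hg : Measurable g) {v w : NNReal}
    (hμ : μ.map f = gaussianReal 0 v) (hν : ν.map g = gaussianReal 0 w) :
    (μ.prod ν).map (fun p => f p.1 + g p.2) = gaussianReal 0 (v + w) := by
  have hX : (μ.prod ν).map (fun p => f p.1) = gaussianReal 0 v := by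
    rw [← hμ, show (fun p : α × β => f p.1) = f ∘ Prod.fst from rfl,
      ← Measure.map_map hf measurable_fst, Measure.map_fst_prod, measure_univ, one_smul]
  have hY : (μ.prod ν).map (fun p => g p.2) = gaussianReal 0 w := by
    rw [← hν, show (fun p : α × β => g p.2) = g ∘ Prod.snd from rfl,
      ← Measure.map_map hg measurable_snd, Measure.map_snd_prod, measure_univ, one_smul]
  have h := gaussianReal_add_gaussianReal_of_indepFun (indepFun_prod hf hg) hX hY
  rwa [add_zero] at h

lemma map_re_mul_complexGaussian {v : ℝ} (hv : 0 ≤ v) (c : ℂ) :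
    (complexGaussian v).map (fun n => (c * n).re) =
      gaussianReal 0 (‖c‖ ^ 2 * (v / 2)).toNNReal := by
  rw [complexGaussian, Measure.map_map (by fun_prop) measurable_complex_mk]
  have h := map_add_prod_gaussianReal (f := (c.re * ·)) (g := (-c.im * ·)) (by fun_prop)
    (by fun_prop) (gaussianReal_map_const_mul (μ := 0) (v := (v / 2).toNNReal) c.re |>.trans
      (by rw [mul_zero])) (gaussianReal_map_const_mul (μ := 0) (v := (v / 2).toNNReal) (-c.im)
      |>.trans (by rw [mul_zero]))
  convert! h using 1
  · congr 1
    funext p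
    simp [Complex.mul_re, sub_eq_add_neg]
  · congr 1
    ext
    push_cast
    rw [Real.coe_toNNReal _ (by positivity), Real.coe_toNNReal _ (by positivity),
      ← Complex.normSq_eq_norm_sq, Complex.normSq_apply]
    simp
    ring

/-- The noise samples of one symbol interval in the slots of a user, of the other user and of the
relay. -/
noncomputable abbrev noiseTriple (v : ℝ) : Measure ((ℂ × ℂ) × ℂ) :=
  ((complexGaussian v).prod (complexGaussian v)).prod (complexGaussian v)

lemma map_re_combination_noiseTriple {v : ℝ} (hv : 0 ≤ v) (c₁ c₂ c₃ : ℂ) :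
    (noiseTriple v).map (fun n => (c₁ * n.1.1 + c₂ * n.1.2 + c₃ * n.2).re) =
      gaussianReal 0 ((‖c₁‖ ^ 2 + ‖c₂‖ ^ 2 + ‖c₃‖ ^ 2) * (v / 2)).toNNReal := by
  have h := map_add_prod_gaussianReal (f := fun n : ℂ × ℂ => (c₁ * n.1).re + (c₂ * n.2).re)
    (g := fun n => (c₃ * n).re) (by fun_prop) (by fun_prop)
    (map_add_prod_gaussianReal (f := fun n => (c₁ * n).re) (g := fun n => (c₂ * n).re)
      (by fun_prop) (by fun_prop) (map_re_mul_complexGaussian hv c₁)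
      (map_re_mul_complexGaussian hv c₂)) (map_re_mul_complexGaussian hv c₃)
  convert! h using 1
  rw [← Real.toNNReal_add (by positivity) (by positivity),
    ← Real.toNNReal_add (by positivity) (by positivity)]
  ring_nf

/-! ### Detection with known gains -/

lemma measurable_slicer : Measurable slicer := by
  refine measurable_to_bool ?_
  have : slicer ⁻¹' {true} = {z : ℂ | 0 ≤ z.re} := by
    ext z
    simp [slicer]
  rw [this]
  exact measurableSet_le measurable_const Complex.measurable_re

/-- The error probability of a BPSK decision on a statistic that is the symbol with gain
`G = ∑ |cᵢ|²` in the noise `∑ cᵢ nᵢ`. All the detectors of the destination are of this form. -/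
lemma noiseTriple_error {P N0 : ℝ} (hP : 0 < P) (hN0 : 0 < N0) (b : Bool) {G : ℝ} (hG : 0 < G)
    {c₁ c₂ c₃ : ℂ} (hc : ‖c₁‖ ^ 2 + ‖c₂‖ ^ 2 + ‖c₃‖ ^ 2 = G) :
    noiseTriple N0 {n | slicer (G * bpsk P b + (c₁ * n.1.1 + c₂ * n.1.2 + c₃ * n.2)) ≠ b} =
      gaussianTail (P / N0 * G) := by
  have hv : (G * (N0 / 2)).toNNReal ≠ 0 := by
    rw [ne_eq, Real.toNNReal_eq_zero, not_le]; positivity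
  have htail : gaussianReal 0 (G * (N0 / 2)).toNNReal (Ici (G * √P)) =
      gaussianTail (P / N0 * G) := by
    rw [gaussianReal_Ici_eq_gaussianTail hv (by positivity), Real.coe_toNNReal _ (by positivity),
      mul_pow, Real.sq_sqrt hP.le]
    congr 1
    field_simp
  have hmap := map_re_combination_noiseTriple hN0.le c₁ c₂ c₃
  rw [hc] at hmap
  have hm : Measurable fun n : (ℂ × ℂ) × ℂ => (c₁ * n.1.1 + c₂ * n.1.2 + c₃ * n.2).re := by
    fun_prop
  cases b with
  | false =>
    rw [← htail, ← hmap, Measure.map_apply hm measurableSet_Ici]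
    congr 1
    ext n
    simp only [slicer, bpsk, Bool.false_eq_true, if_false, mem_ofPred_eq, mem_preimage, mem_Ici,
      ne_eq, decide_eq_false_iff_not, not_not]
    rw [mul_neg, ← Complex.ofReal_mul, ← Complex.ofReal_neg, Complex.add_re, Complex.ofReal_re]
    constructor <;> intro h <;> linarith
  | true =>
    rw [← htail, ← gaussianReal_Iio_neg hv, ← hmap, Measure.map_apply hm measurableSet_Iio]
    congr 1
    ext n
    simp only [slicer, bpsk, if_true, mem_ofPred_eq, mem_preimage, mem_Iio,
      ne_eq, decide_eq_true_eq, not_le]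
    rw [← Complex.ofReal_mul, Complex.add_re, Complex.ofReal_re]
    constructor <;> intro h <;> linarith

/-! ### The laws of gains and noise at the destination -/

lemma User.other_other (u : User) : u.other.other = u := by cases u <;> rfl

lemma User.eq_or_eq_other (u v : User) : v = u ∨ v = u.other := by
  cases u <;> cases v <;> simp [User.other]

lemma User.other_ne (u : User) : u.other ≠ u := by cases u <;> simp [User.other]

lemma User.prod_eq {R : Type*} [CommMonoid R] (f : User → R) : ∏ v, f v = f .A * f .B :=
  Finset.prod_pair (by simp)

lemma User.prod_eq_other {R : Type*} [CommMonoid R] (u : User) (f : User → R) :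
    ∏ v, f v = f u * f u.other := by
  cases u
  · exact User.prod_eq f
  · rw [User.prod_eq, mul_comm]; rfl

lemma map_pi_user {α : Type*} [MeasurableSpace α] (ν : Measure α) [IsProbabilityMeasure ν]
    (u : User) :
    (Measure.pi fun _ : User => ν).map (fun h => (h u, h u.other)) = ν.prod ν := by
  refine (Measure.prod_eq fun s t hs ht => ?_).symm
  rw [Measure.map_apply (by fun_prop) (hs.prod ht)]
  have : (fun h : User → α => (h u, h u.other)) ⁻¹' (s ×ˢ t) =
      univ.pi (fun v => if v = u then s else t) := by
    ext h
    simp only [mem_preimage, mem_prod, mem_univ_pi]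
    constructor
    · rintro ⟨h1, h2⟩ v
      rcases User.eq_or_eq_other u v with rfl | rfl
      · simpa using h1
      · simpa [User.other_ne] using h2
    · intro hv
      have h1 := hv u
      have h2 := hv u.other
      simp only [if_true, User.other_ne, if_false] at h1 h2
      exact ⟨h1, h2⟩
  rw [this, Measure.pi_pi, User.prod_eq_other u]
  simp [User.other_ne]

lemma map_pi_user_prod {α β γ δ : Type*} [MeasurableSpace α] [MeasurableSpace β]
    [MeasurableSpace γ] [MeasurableSpace δ] (ν : Measure α) [IsProbabilityMeasure ν]
    (ν' : Measure γ) [IsProbabilityMeasure ν'] {f : α → β} {g : γ → δ} (hf : Measurable f)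
    (hg : Measurable g) (u : User) :
    ((Measure.pi fun _ : User => ν).prod ν').map
        (fun h => ((f (h.1 u), f (h.1 u.other)), g h.2)) =
      ((ν.map f).prod (ν.map f)).prod (ν'.map g) := by
  rw [Measure.map_prod_map _ _ hf hf, ← map_pi_user ν u, Measure.map_map (by fun_prop)
    (by fun_prop), Measure.map_prod_map _ _ (by fun_prop) hg]
  rfl

/-- The gains of the users and of the relay. -/
abbrev DestGains : Type := (User → ℂ) × ℂ

/-- The noise at the destination. -/
abbrev DestNoise (n : ℕ) : Type := (User → Fin n → ℂ) × (Fin n → ℂ)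

/-- The law of the gains of the links to the destination. -/
noncomputable abbrev destGainLaw (Ω : ℝ) : Measure DestGains :=
  (Measure.pi fun _ : User => complexGaussian (1 / Ω)).prod (complexGaussian (1 / Ω))

/-- The law of the noise at the destination. -/
noncomputable abbrev destNoiseLaw (n : ℕ) (N0 : ℝ) : Measure (DestNoise n) :=
  (Measure.pi fun _ : User => Measure.pi fun _ : Fin n => complexGaussian N0).prod
    (Measure.pi fun _ : Fin n => complexGaussian N0)

/-- The squared gains of user `u`, of the other user and of the relay. -/
noncomputable def sqGains (u : User) (g : DestGains) : ℝ × ℝ × ℝ :=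
  (‖g.1 u‖ ^ 2, ‖g.1 u.other‖ ^ 2, ‖g.2‖ ^ 2)

lemma measurable_sqGains (u : User) : Measurable (sqGains u) := by
  unfold sqGains
  fun_prop

lemma map_sqGains_destGainLaw {Ω : ℝ} (hΩ : 0 < Ω) (u : User) :
    (destGainLaw Ω).map (sqGains u) = sqGainLaw Ω := by
  have := isProbabilityMeasure_expMeasure hΩ
  have h := map_pi_user_prod (complexGaussian (1 / Ω)) (complexGaussian (1 / Ω))
    (f := fun h => ‖h‖ ^ 2) (g := fun h => ‖h‖ ^ 2) (by fun_prop) (by fun_prop) u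
  rw [map_normSq_complexGaussian hΩ] at h
  rw [sqGainLaw, ← Measure.prodAssoc_prod, ← h, Measure.map_map (by fun_prop) (by fun_prop)]
  rfl

lemma map_destNoiseLaw {n : ℕ} (N0 : ℝ) (u : User) (j : Fin n) :
    (destNoiseLaw n N0).map (fun N => ((N.1 u j, N.1 u.other j), N.2 j)) = noiseTriple N0 := by
  have h := map_pi_user_prod (Measure.pi fun _ : Fin n => complexGaussian N0)
    (Measure.pi fun _ : Fin n => complexGaussian N0)
    (f := fun x => x j) (g := fun x => x j) (by fun_prop) (by fun_prop) u
  have he : (Measure.pi fun _ : Fin n => complexGaussian N0).map (fun x => x j)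
      = complexGaussian N0 :=
    (measurePreserving_eval (fun _ : Fin n => complexGaussian N0) j).map_eq
  rwa [he] at h

lemma destNoiseLaw_error {n : ℕ} {P N0 : ℝ} (hP : 0 < P) (hN0 : 0 < N0) (u : User) (j : Fin n)
    (b : Bool) {G : ℝ} (hG : 0 < G) {c₁ c₂ c₃ : ℂ} (hc : ‖c₁‖ ^ 2 + ‖c₂‖ ^ 2 + ‖c₃‖ ^ 2 = G) :
    destNoiseLaw n N0 {N | slicer (G * bpsk P b +
        (c₁ * N.1 u j + c₂ * N.1 u.other j + c₃ * N.2 j)) ≠ b} =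
      gaussianTail (P / N0 * G) := by
  rw [← noiseTriple_error hP hN0 b hG hc, ← map_destNoiseLaw N0 u j,
    Measure.map_apply (by fun_prop)]
  · rfl
  · have : Measurable fun n : (ℂ × ℂ) × ℂ =>
        slicer (G * bpsk P b + (c₁ * n.1.1 + c₂ * n.1.2 + c₃ * n.2)) :=
      measurable_slicer.comp (by fun_prop)
    exact this (MeasurableSet.of_discrete (s := {b}ᶜ))

/-- If the conditional error probability given the gains is bounded by a function of the squared
gains, then averaging over exponential variables bounds the error probability. Vanishing gains, for
which a tie of the decision rule or a division by zero matters, form a null set. -/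
lemma dest_error_le {n : ℕ} {Ω N0 : ℝ} (hΩ : 0 < Ω) (u : User)
    {dec : DestGains × DestNoise n → Bool} (hdec : Measurable dec) (b : Bool)
    {F : ℝ × ℝ × ℝ → ℝ≥0∞} (hF : Measurable F)
    (h : ∀ g : DestGains, g.1 u ≠ 0 → g.1 u.other ≠ 0 → g.2 ≠ 0 →
      destNoiseLaw n N0 {N | dec (g, N) ≠ b} ≤ F (sqGains u g)) :
    (destGainLaw Ω).prod (destNoiseLaw n N0) {d | dec d ≠ b} ≤ ∫⁻ p, F p ∂sqGainLaw Ω := by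
  have hm : MeasurableSet {d | dec d ≠ b} := hdec (MeasurableSet.of_discrete (s := {b}ᶜ))
  rw [Measure.prod_apply hm, ← map_sqGains_destGainLaw hΩ u,
    lintegral_map hF (measurable_sqGains u)]
  refine lintegral_mono_ae ?_
  have hpos := ae_pos_sqGainLaw hΩ
  rw [← map_sqGains_destGainLaw hΩ u] at hpos
  filter_upwards [ae_of_ae_map (measurable_sqGains u).aemeasurable hpos] with g hg
  simp only [sqGains] at hg
  refine h g ?_ ?_ ?_ <;> intro h0 <;> simp [h0] at hg

/-! ### The detectors as decisions in Gaussian noise -/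

lemma star_mul_self_eq (z : ℂ) : star z * z = ((‖z‖ ^ 2 : ℝ) : ℂ) := by
  rw [← Complex.normSq_eq_norm_sq, Complex.normSq_eq_conj_mul_self]
  rfl

lemma directDetect_eq (h x N₁ N₂ N₃ : ℂ) :
    directDetect h (h * x + N₁) =
      slicer (((‖h‖ ^ 2 : ℝ) : ℂ) * x + (star h * N₁ + 0 * N₂ + 0 * N₃)) := by
  rw [directDetect, ← star_mul_self_eq]
  ring_nf

lemma mrcDetect_eq (h hR x N₁ N₂ N₃ : ℂ) :
    mrcDetect h (h * x + N₁) hR (hR * x + N₃) =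
      slicer (((‖h‖ ^ 2 + ‖hR‖ ^ 2 : ℝ) : ℂ) * x + (star h * N₁ + 0 * N₂ + star hR * N₃)) := by
  rw [mrcDetect, Complex.ofReal_add, ← star_mul_self_eq, ← star_mul_self_eq]
  ring_nf

lemma interfNorm_pos {hv hR : ℂ} (hR0 : hR ≠ 0) : 0 < interfNorm hv hR := by
  unfold interfNorm
  positivity

lemma interfNorm_sq (hv hR : ℂ) : interfNorm hv hR ^ 2 = ‖hv‖ ^ 2 + ‖hR‖ ^ 2 :=
  Real.sq_sqrt (by positivity)

lemma norm_nulledGain_sq (hv hR : ℂ) :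
    ‖nulledGain hv hR‖ ^ 2 = ‖hv‖ ^ 2 * ‖hR‖ ^ 2 / (‖hv‖ ^ 2 + ‖hR‖ ^ 2) := by
  rw [nulledGain, norm_div, norm_mul, div_pow, mul_pow, Complex.norm_real, Real.norm_eq_abs, sq_abs,
    interfNorm_sq, mul_comm]

/-- Nulling removes the interfering symbol `x'`. By `nulling_noise_coefficients` the noise
coefficients satisfy the assumption of `destNoiseLaw_error`. -/
lemma nullingDetect_eq (h : User → ℂ) (hR x x' : ℂ) (y N : User → ℂ) (NR : ℂ) (u : User)
    (hu : y u = h u * x + N u) (hv : y u.other = h u.other * x' + N u.other) :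
    nullingDetect h hR y (hR * (x + x') + NR) u =
      slicer (((‖h u‖ ^ 2 + ‖nulledGain (h u.other) hR‖ ^ 2 : ℝ) : ℂ) * x +
        (star (h u) * N u +
          -(star (nulledGain (h u.other) hR) * hR / interfNorm (h u.other) hR) * N u.other +
          star (nulledGain (h u.other) hR) * h u.other / interfNorm (h u.other) hR * NR)) := by
  rw [nullingDetect, mrcDetect, Complex.ofReal_add, ← star_mul_self_eq, ← star_mul_self_eq, hu, hv,
    nulled]
  congr 1
  generalize star (nulledGain (h u.other) hR) = g
  simp only [nulledGain]
  ring

lemma nulling_noise_coefficients {hv hR : ℂ} (hR0 : hR ≠ 0) (h : ℂ) :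
    ‖star h‖ ^ 2 + ‖-(star (nulledGain hv hR) * hR / interfNorm hv hR)‖ ^ 2 +
      ‖star (nulledGain hv hR) * hv / interfNorm hv hR‖ ^ 2 =
      ‖h‖ ^ 2 + ‖nulledGain hv hR‖ ^ 2 := by
  have h0 := interfNorm_sq hv hR
  have hpos := interfNorm_pos (hv := hv) hR0
  have e : ‖nulledGain hv hR‖ ^ 2 * (‖hv‖ ^ 2 + ‖hR‖ ^ 2) / interfNorm hv hR ^ 2 =
      ‖nulledGain hv hR‖ ^ 2 := by
    rw [← h0]
    field_simp
  rw [norm_neg, norm_div, norm_div, norm_mul, norm_mul, norm_star, norm_star, Complex.norm_real,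
    Real.norm_eq_abs, div_pow, div_pow, mul_pow, mul_pow, sq_abs]
  rw [add_assoc, ← add_div, ← mul_add, add_comm (‖hR‖ ^ 2), e]

/-! ### The order of detection -/

lemma nullingSNR_eq (P N0 : ℝ) (g : DestGains) (u : User) :
    nullingSNR P N0 g.1 g.2 u = nullingSqGain (sqGains u g) * (P / N0) := by
  simp only [nullingSNR, nullingSqGain, sqGains, norm_mul, mul_pow]

lemma nullingSNR_le_of_eq_firstUser {P N0 : ℝ} {h : User → ℂ} {hR : ℂ} {u : User}
    (hu : u = firstUser P N0 h hR) :
    nullingSNR P N0 h hR u.other ≤ nullingSNR P N0 h hR u := by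
  unfold firstUser at hu
  split_ifs at hu with hle
  · subst hu; exact hle
  · subst hu; exact (not_le.1 hle).le

lemma nullingSNR_le_of_ne_firstUser {P N0 : ℝ} {h : User → ℂ} {hR : ℂ} {u : User}
    (hu : u ≠ firstUser P N0 h hR) :
    nullingSNR P N0 h hR u ≤ nullingSNR P N0 h hR u.other := by
  have h1 : u.other = firstUser P N0 h hR :=
    ((User.eq_or_eq_other u (firstUser P N0 h hR)).resolve_left (Ne.symm hu)).symm
  simpa only [User.other_other] using nullingSNR_le_of_eq_firstUser h1

lemma nullingSNR_other_le_iff {P N0 : ℝ} (hP : 0 < P) (hN0 : 0 < N0) {g : DestGains} {u : User}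
    (hu : g.1 u ≠ 0) (hv : g.1 u.other ≠ 0) (hR : g.2 ≠ 0) :
    nullingSNR P N0 g.1 g.2 u.other ≤ nullingSNR P N0 g.1 g.2 u ↔
      ‖g.1 u.other‖ ^ 2 ≤ ‖g.1 u‖ ^ 2 := by
  rw [nullingSNR_eq, nullingSNR_eq, mul_le_mul_iff_left₀ (div_pos hP hN0)]
  simp only [sqGains, User.other_other]
  exact nullingSqGain_le_iff (by positivity) (by positivity) (by positivity)

lemma measurableSet_eq_firstUser (P N0 : ℝ) (u : User) :
    MeasurableSet {g : DestGains | u = firstUser P N0 g.1 g.2} := by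
  have hA : MeasurableSet
      {g : DestGains | nullingSNR P N0 g.1 g.2 .B ≤ nullingSNR P N0 g.1 g.2 .A} := by
    unfold nullingSNR
    exact measurableSet_le (by fun_prop) (by fun_prop)
  cases u with
  | A =>
    convert hA using 1
    ext g
    simp only [firstUser, mem_ofPred_eq]
    split_ifs with h <;> simp [h]
  | B =>
    convert hA.compl using 1
    ext g
    simp only [firstUser, mem_ofPred_eq, mem_compl_iff]
    split_ifs with h <;> simp [h]

/-! ### Error probabilities in a given state of the relay -/

/-- The signal that the relay sends in state `s` when the message blocks are `m`. -/
noncomputable def relayedSignal {n : ℕ} (P : ℝ) (m : User → Block n) (s : RelayState) (j : Fin n) :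
    ℂ :=
  match s with
  | .s0 => 0
  | .s1 => bpsk P (m .A j)
  | .s2 => bpsk P (m .B j)
  | .s3 => bpsk P (m .A j) + bpsk P (m .B j)

lemma relayedSignal_only {n : ℕ} (P : ℝ) (m : User → Block n) (u : User) (j : Fin n) :
    relayedSignal P m (.only u) j = bpsk P (m u j) := by
  cases u <;> rfl

lemma relayedSignal_both {n : ℕ} (P : ℝ) (m : User → Block n) (u : User) (j : Fin n) :
    relayedSignal P m .s3 j = bpsk P (m u j) + bpsk P (m u.other j) := by
  cases u
  · rfl
  · exact add_comm _ _

/-- The sample received from user `v` as a function of message, gains and noise. -/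
noncomputable def userSample {n : ℕ} (P : ℝ) (m : User → Block n) (d : DestGains × DestNoise n)
    (j : Fin n) (v : User) : ℂ :=
  d.1.1 v * bpsk P (m v j) + d.2.1 v j

/-- The sample received from the relay as a function of message, state, gains and noise. -/
noncomputable def relaySample {n : ℕ} (P : ℝ) (m : User → Block n) (s : RelayState)
    (d : DestGains × DestNoise n) (j : Fin n) : ℂ :=
  d.1.2 * relayedSignal P m s j + d.2.2 j

/-- The decision on bit `j` of user `u` when the message blocks `m` and the state `s` of the relay
are fixed, as a function of the gains and the noise at the destination. -/
noncomputable def stateDetected {n : ℕ} (P N0 : ℝ) (m : User → Block n) (s : RelayState) (u : User)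
    (j : Fin n) (d : DestGains × DestNoise n) : Bool :=
  let direct := directDetect (d.1.1 u) (userSample P m d j u)
  let mrc := mrcDetect (d.1.1 u) (userSample P m d j u) d.1.2 (relaySample P m s d j)
  match s, u with
  | .s0, _ => direct
  | .s1, .A => mrc
  | .s1, .B => direct
  | .s2, .A => direct
  | .s2, .B => mrc
  | .s3, u =>
    vblastDetect P N0 d.1.1 d.1.2 (userSample P m d j) (relaySample P m .s3 d j)
      (bpsk P (m (firstUser P N0 d.1.1 d.1.2) j)) u

section

variable {n : ℕ} (P N0 : ℝ) (m : User → Block n) (u : User) (j : Fin n)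

lemma measurable_userSample (v : User) : Measurable fun d => userSample P m d j v := by
  unfold userSample
  fun_prop

lemma measurable_relaySample (s : RelayState) : Measurable fun d => relaySample P m s d j := by
  unfold relaySample
  fun_prop

lemma stateDetected_other (d : DestGains × DestNoise n) :
    stateDetected P N0 m (.only u.other) u j d = stateDetected P N0 m .s0 u j d := by
  cases u <;> rfl

lemma stateDetected_only (d : DestGains × DestNoise n) :
    stateDetected P N0 m (.only u) u j d =
      mrcDetect (d.1.1 u) (userSample P m d j u) d.1.2 (relaySample P m (.only u) d j) := by
  cases u <;> rfl

lemma stateDetected_both (d : DestGains × DestNoise n) :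
    stateDetected P N0 m .s3 u j d =
      if u = firstUser P N0 d.1.1 d.1.2 then
        nullingDetect d.1.1 d.1.2 (userSample P m d j) (relaySample P m .s3 d j) u
      else mrcDetect (d.1.1 u) (userSample P m d j u) d.1.2
        (relaySample P m .s3 d j - d.1.2 * bpsk P (m u.other j)) := by
  simp only [stateDetected, vblastDetect]
  split_ifs with h
  · rfl
  · rw [(User.eq_or_eq_other u (firstUser P N0 d.1.1 d.1.2)).resolve_left (Ne.symm h)]

lemma measurable_stateDetected_silent : Measurable (stateDetected P N0 m .s0 u j) := by
  have h1 := measurable_userSample P m j u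
  exact measurable_slicer.comp (by fun_prop)

lemma measurable_stateDetected_only : Measurable (stateDetected P N0 m (.only u) u j) := by
  have h1 := measurable_userSample P m j u
  have h2 := measurable_relaySample P m j (.only u)
  simp only [funext (stateDetected_only P N0 m u j)]
  exact measurable_slicer.comp (by fun_prop)

lemma measurable_stateDetected_both : Measurable (stateDetected P N0 m .s3 u j) := by
  have h1 := measurable_userSample P m j u
  have h2 := measurable_userSample P m j u.other
  have h3 := measurable_relaySample P m j .s3
  rw [funext (stateDetected_both P N0 m u j)]
  refine Measurable.ite ?_ (measurable_slicer.comp ?_) (measurable_slicer.comp (by fun_prop))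
  · exact measurable_fst (measurableSet_eq_firstUser P N0 u)
  · unfold nulled nulledGain interfNorm
    fun_prop

variable {P N0} {Ω : ℝ}

lemma error_direct_le (hP : 0 < P) (hN0 : 0 < N0) (hΩ : 0 < Ω) :
    (destGainLaw Ω).prod (destNoiseLaw n N0) {d | stateDetected P N0 m .s0 u j d ≠ m u j} ≤
      ENNReal.ofReal (1 / 2 * (Ω / (P / N0 + Ω))) := by
  refine (dest_error_le hΩ u (measurable_stateDetected_silent P N0 m u j) _
    (F := fun p => gaussianTail (P / N0 * p.1)) (measurable_gaussianTail.comp (by fun_prop)) ?_).trans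
    (lintegral_gaussianTail_direct_le hΩ (div_pos hP hN0))
  intro g hu hv hR
  refine le_of_eq ?_
  have h := destNoiseLaw_error (n := n) hP hN0 u j (m u j) (G := ‖g.1 u‖ ^ 2) (c₁ := star (g.1 u))
    (c₂ := 0) (c₃ := 0) (by positivity) (by simp)
  refine Eq.trans ?_ h
  congr 1
  ext N
  simp only [mem_ofPred_eq]
  rw [← directDetect_eq]
  rfl

lemma error_mrc_le (hP : 0 < P) (hN0 : 0 < N0) (hΩ : 0 < Ω) :
    (destGainLaw Ω).prod (destNoiseLaw n N0) {d | stateDetected P N0 m (.only u) u j d ≠ m u j} ≤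
      ENNReal.ofReal (1 / 2 * (Ω / (P / N0 + Ω)) ^ 2) := by
  refine (dest_error_le hΩ u (measurable_stateDetected_only P N0 m u j) _
    (F := fun p => gaussianTail (P / N0 * (p.1 + p.2.2)))
    (measurable_gaussianTail.comp (by fun_prop)) ?_).trans
    (lintegral_gaussianTail_mrc_le hΩ (div_pos hP hN0))
  intro g hu hv hR
  refine le_of_eq ?_
  have h := destNoiseLaw_error (n := n) hP hN0 u j (m u j) (G := ‖g.1 u‖ ^ 2 + ‖g.2‖ ^ 2)
    (c₁ := star (g.1 u)) (c₂ := 0) (c₃ := star g.2) (by positivity) (by simp)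
  refine Eq.trans ?_ h
  congr 1
  ext N
  simp only [mem_ofPred_eq]
  rw [← mrcDetect_eq, stateDetected_only, userSample, relaySample, relayedSignal_only]

lemma error_both_le (hP : 0 < P) (hN0 : 0 < N0) (hΩ : 0 < Ω) :
    (destGainLaw Ω).prod (destNoiseLaw n N0) {d | stateDetected P N0 m .s3 u j d ≠ m u j} ≤
      ENNReal.ofReal (1 / 4 * (Ω / (Ω + P / N0) * (√Real.pi * Ω ^ 2 *
        (32 * Ω / (Real.Gamma 2.5 * (4 * Ω + P / N0) ^ 3)
            * ordinaryHypergeometric (3 : ℝ) 1.5 2.5 (P / N0 / (4 * Ω + P / N0))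
          + 4 / (Real.Gamma 2.5 * (4 * Ω + P / N0) ^ 2)
            * ordinaryHypergeometric (2 : ℝ) 0.5 2.5 (P / N0 / (4 * Ω + P / N0)))))) +
      ENNReal.ofReal (1 / 4 * (Ω / (Ω + P / N0)) ^ 2) := by
  have hA : MeasurableSet {p : ℝ × ℝ × ℝ | p.2.1 ≤ p.1} :=
    measurableSet_le (by fun_prop) (by fun_prop)
  have hB : MeasurableSet {p : ℝ × ℝ × ℝ | p.1 ≤ p.2.1} :=
    measurableSet_le (by fun_prop) (by fun_prop)
  have hf1 : Measurable ({p : ℝ × ℝ × ℝ | p.2.1 ≤ p.1}.indicator fun p =>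
      gaussianTail (P / N0 * nullingSqGain p)) :=
    (measurable_gaussianTail.comp (measurable_nullingSqGain.const_mul _)).indicator hA
  have hf2 : Measurable ({p : ℝ × ℝ × ℝ | p.1 ≤ p.2.1}.indicator fun p =>
      gaussianTail (P / N0 * (p.1 + p.2.2))) :=
    (measurable_gaussianTail.comp (by fun_prop)).indicator hB
  have hs := div_pos hP hN0
  refine (dest_error_le hΩ u (measurable_stateDetected_both P N0 m u j) _ (hf1.add hf2) ?_).trans ?_
  · intro g hu hv hR
    by_cases hfirst : u = firstUser P N0 g.1 g.2
    · have hle := (nullingSNR_other_le_iff hP hN0 hu hv hR).1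
        (nullingSNR_le_of_eq_firstUser hfirst)
      refine le_trans (le_of_eq ?_) (le_add_of_nonneg_right zero_le)
      rw [indicator_of_mem (by exact hle)]
      have h := destNoiseLaw_error (n := n) hP hN0 u j (m u j)
        (by positivity) (nulling_noise_coefficients (hv := g.1 u.other) hR (g.1 u))
      rw [norm_nulledGain_sq] at h
      refine Eq.trans ?_ h
      congr 1
      ext N
      simp only [mem_ofPred_eq]
      rw [stateDetected_both, if_pos hfirst, relaySample, relayedSignal_both P m u j,
        nullingDetect_eq _ _ _ (bpsk P (m u.other j)) _ (fun v => N.1 v j) _ _ rfl rfl,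
        norm_nulledGain_sq]
    · have hle : ‖g.1 u‖ ^ 2 ≤ ‖g.1 u.other‖ ^ 2 := by
        have := (nullingSNR_other_le_iff hP hN0 (u := u.other) hv
          (by rwa [User.other_other]) hR).1
        simp only [User.other_other] at this
        exact this (nullingSNR_le_of_ne_firstUser hfirst)
      refine le_trans (le_of_eq ?_) (le_add_of_nonneg_left zero_le)
      rw [indicator_of_mem (by exact hle)]
      have h := destNoiseLaw_error (n := n) hP hN0 u j (m u j) (G := ‖g.1 u‖ ^ 2 + ‖g.2‖ ^ 2)
        (c₁ := star (g.1 u)) (c₂ := 0) (c₃ := star g.2) (by positivity) (by simp)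
      refine Eq.trans ?_ h
      congr 1
      ext N
      simp only [mem_ofPred_eq]
      have hsub : relaySample P m .s3 (g, N) j - g.2 * bpsk P (m u.other j) =
          g.2 * bpsk P (m u j) + N.2 j := by
        rw [relaySample, relayedSignal_both P m u j]
        ring
      rw [← mrcDetect_eq, stateDetected_both, if_neg hfirst, hsub, userSample]
  · simp only [Pi.add_apply]
    rw [lintegral_add_left hf1, lintegral_indicator hA, lintegral_indicator hB]
    exact add_le_add (lintegral_gaussianTail_first_le hΩ hs)
      (lintegral_gaussianTail_second_le hΩ hs)

end

/-! ### The state of the relay -/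

/-- All that the relay's decision on one user depends on: message, gain and noise. -/
abbrev UserSlice (n : ℕ) : Type := Block n × ℂ × (Fin n → ℂ)

/-- The law of message, gain and noise of one user-relay link. -/
noncomputable abbrev sliceLaw {n : ℕ} (ν : Measure (Block n)) (ΩR NR : ℝ) : Measure (UserSlice n) :=
  ν.prod ((complexGaussian (1 / ΩR)).prod (Measure.pi fun _ : Fin n => complexGaussian NR))

/-- The part of the sample that concerns the link from user `u` to the relay. -/
def slice {n : ℕ} (ω : Sample n) (u : User) : UserSlice n :=
  (ω.msg u, ω.gainUR u, ω.noiseUR u)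

section

variable {n : ℕ} (M : User → Measure (Block n)) [∀ u, IsProbabilityMeasure (M u)]
  (ΩR ΩD NR N0 : ℝ)

instance isProbabilityMeasure_law : IsProbabilityMeasure (law M ΩR ΩD NR N0) := by
  unfold law
  infer_instance

/-- The links to the relay of the two users are independent. -/
lemma map_slice_law :
    (law M ΩR ΩD NR N0).map slice = Measure.pi fun u => sliceLaw (M u) ΩR NR := by
  have h1 := measurePreserving_arrowProdEquivProdArrow ℂ (Fin n → ℂ) User
    (fun _ => complexGaussian (1 / ΩR)) (fun _ => Measure.pi fun _ : Fin n => complexGaussian NR)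
  have h2 := measurePreserving_arrowProdEquivProdArrow (Block n) (ℂ × (Fin n → ℂ)) User M
    (fun _ => (complexGaussian (1 / ΩR)).prod (Measure.pi fun _ : Fin n => complexGaussian NR))
  have h3 := ((MeasurePreserving.id (Measure.pi M)).prod h1.symm)
  have h4 := (MeasurePreserving.id (Measure.pi M)).prod
    (measurePreserving_fst (μ := (Measure.pi fun _ : User => complexGaussian (1 / ΩR)).prod
        (Measure.pi fun _ : User => Measure.pi fun _ : Fin n => complexGaussian NR))
      (ν := (destGainLaw ΩD).prod (destNoiseLaw n N0)))
  exact ((h2.symm.comp h3).comp h4).map_eq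

lemma law_slice_mem {t : User → Set (UserSlice n)} (ht : ∀ u, MeasurableSet (t u)) :
    (law M ΩR ΩD NR N0) {ω | ∀ u, slice ω u ∈ t u} = ∏ u, sliceLaw (M u) ΩR NR (t u) := by
  have hm : Measurable (slice (n := n)) := by
    unfold slice Sample.msg Sample.gainUR Sample.noiseUR
    fun_prop
  rw [← Measure.pi_pi, ← map_slice_law M ΩR ΩD NR N0,
    Measure.map_apply hm (MeasurableSet.univ_pi ht)]
  congr 1
  ext ω
  simp

variable (D : RelayDecoder n) (P : ℝ)

/-- The event that the relay decodes the block of user `u` correctly. -/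
def decodedSet (u : User) : Set (UserSlice n) :=
  {x | D u x.2.1 (fun j => x.2.1 * bpsk P (x.1 j) + x.2.2 j) = x.1}

lemma slice_mem_decodedSet (ω : Sample n) (u : User) :
    slice ω u ∈ decodedSet D P u ↔ relayEst D P ω u = ω.msg u := Iff.rfl

lemma measurableSet_decodedSet (hD : ∀ u, Measurable fun p : ℂ × (Fin n → ℂ) => D u p.1 p.2)
    (u : User) : MeasurableSet (decodedSet D P u) := by
  have hb : Measurable (bpsk P) := measurable_of_countable _
  have h : Measurable fun x : UserSlice n =>
      (x.2.1, fun j => x.2.1 * bpsk P (x.1 j) + x.2.2 j) := by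
    refine Measurable.prodMk (by fun_prop) (measurable_pi_lambda _ fun j => ?_)
    have : Measurable fun x : UserSlice n => bpsk P (x.1 j) := hb.comp (by fun_prop)
    fun_prop
  exact measurableSet_eq_fun ((hD u).comp h) (by fun_prop)

/-- The sets of links on which the relay is in state `s`. -/
def stateSet (s : RelayState) (u : User) : Set (UserSlice n) :=
  match s, u with
  | .s0, _ => (decodedSet D P u)ᶜ
  | .s1, .A => decodedSet D P .A
  | .s1, .B => (decodedSet D P .B)ᶜ
  | .s2, .A => (decodedSet D P .A)ᶜ
  | .s2, .B => decodedSet D P .B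
  | .s3, _ => decodedSet D P u

lemma User.forall_iff {p : User → Prop} : (∀ u, p u) ↔ p .A ∧ p .B :=
  ⟨fun h => ⟨h _, h _⟩, fun h u => by cases u; exacts [h.1, h.2]⟩

lemma relayState_eq_iff (ω : Sample n) (s : RelayState) :
    relayState D P ω = s ↔ ∀ u, slice ω u ∈ stateSet D P s u := by
  rw [User.forall_iff]
  cases s <;> simp only [stateSet, mem_compl_iff, slice_mem_decodedSet, relayState] <;>
    split_ifs <;> simp_all

lemma relayFailProb_law (hD : ∀ u, Measurable fun p : ℂ × (Fin n → ℂ) => D u p.1 p.2) (u : User) :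
    relayFailProb (law M ΩR ΩD NR N0) D P u =
      (sliceLaw (M u) ΩR NR).real (decodedSet D P u)ᶜ := by
  have hm := measurableSet_decodedSet D P hD
  have h := law_slice_mem M ΩR ΩD NR N0
    (t := fun v => if v = u then (decodedSet D P v)ᶜ else univ)
    (fun v => by split_ifs; exacts [(hm v).compl, MeasurableSet.univ])
  rw [User.prod_eq_other u] at h
  simp only [if_true, User.other_ne, if_false, measure_univ, mul_one] at h
  rw [relayFailProb, measureReal_def, measureReal_def, ← h]
  congr 2
  ext ω
  simp only [mem_ofPred_eq, ne_eq, ← slice_mem_decodedSet]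
  constructor
  · intro h v
    split_ifs with hv
    · subst hv; exact h
    · trivial
  · intro h
    simpa using h u

lemma law_relayState (hD : ∀ u, Measurable fun p : ℂ × (Fin n → ℂ) => D u p.1 p.2)
    (s : RelayState) :
    (law M ΩR ΩD NR N0).real {ω | relayState D P ω = s} =
      stateProb (law M ΩR ΩD NR N0) D P s := by
  have hm := measurableSet_decodedSet D P hD
  have hms : ∀ u, MeasurableSet (stateSet D P s u) := by
    intro u
    cases s <;> cases u <;> first | exact hm _ | exact (hm _).compl
  have hc (u : User) : (sliceLaw (M u) ΩR NR).real (decodedSet D P u) =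
      1 - relayFailProb (law M ΩR ΩD NR N0) D P u := by
    rw [relayFailProb_law M ΩR ΩD NR N0 D P hD, probReal_compl_eq_one_sub (hm u)]
    ring
  simp_rw [relayState_eq_iff]
  rw [measureReal_def, law_slice_mem M ΩR ΩD NR N0 hms, User.prod_eq, ENNReal.toReal_mul,
    ← measureReal_def, ← measureReal_def]
  cases s <;> simp only [stateSet, stateProb, hc, ← relayFailProb_law M ΩR ΩD NR N0 D P hD]

/-! ### The bit error probability -/

/-- Correctly decoded blocks are the true ones, so that the decision depends on the relay only
through its state. -/
lemma detected_eq_stateDetected (ω : Sample n) (u : User) (j : Fin n) :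
    detected D P N0 ω u j = stateDetected P N0 ω.1 (relayState D P ω) u j ω.2.2 := by
  have hest (v : User) (hv : slice ω v ∈ decodedSet D P v) (j : Fin n) :
      relayEst D P ω v j = ω.1 v j := congrFun hv j
  have hst := (relayState_eq_iff D P ω (relayState D P ω)).1 rfl
  have hrx : destRxRelay D P ω j = relaySample P ω.1 (relayState D P ω) ω.2.2 j := by
    have htx : relayTx D P ω j = relayedSignal P ω.1 (relayState D P ω) j := by
      unfold relayTx
      generalize relayState D P ω = s at hst
      cases s
      · rfl
      · simp only [relayedSignal]; rw [hest .A (hst .A)]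
      · simp only [relayedSignal]; rw [hest .B (hst .B)]
      · simp only [relayedSignal]; rw [hest .A (hst .A), hest .B (hst .B)]
    rw [destRxRelay, htx]
    rfl
  unfold detected
  rw [hrx]
  generalize relayState D P ω = s
  cases s <;> cases u <;> rfl

end

section

variable {n : ℕ} (M : User → Measure (Block n)) (ΩR ΩD NR N0 : ℝ) (D : RelayDecoder n) (P : ℝ)

/-- For fixed messages, the state of the relay is independent of the links to the destination. -/
lemma law_state_error_le (s : RelayState) (u : User) (j : Fin n) {B : ℝ≥0∞}
    (hB : ∀ m, (destGainLaw ΩD).prod (destNoiseLaw n N0)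
      {d | stateDetected P N0 m s u j d ≠ m u j} ≤ B) :
    law M ΩR ΩD NR N0 {ω | relayState D P ω = s ∧ detected D P N0 ω u j ≠ ω.msg u j} ≤
      law M ΩR ΩD NR N0 {ω | relayState D P ω = s} * B := by
  set μ := law M ΩR ΩD NR N0 with hμ
  have hmsg (E : Set (Sample n)) : μ E = ∑ m, μ ({ω | ω.1 = m} ∩ E) := by
    have h := sum_measure_preimage_singleton (μ := μ.restrict E)
      (Finset.univ : Finset (User → Block n)) (f := fun ω => ω.1)
      (fun m _ => measurable_fst (measurableSet_singleton m))
    simp only [Finset.coe_univ, preimage_univ, Measure.restrict_apply_univ] at h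
    rw [← h]
    refine Finset.sum_congr rfl fun m _ => ?_
    rw [Measure.restrict_apply (measurable_fst (measurableSet_singleton m))]
    rfl
  rw [hmsg, hmsg {ω | relayState D P ω = s}, Finset.sum_mul]
  refine Finset.sum_le_sum fun m _ => ?_
  set R : Set ((User → ℂ) × (User → Fin n → ℂ)) := {r | relayState D P (m, r, 0) = s}
  have h1 : {ω : Sample n | ω.1 = m} ∩
      {ω | relayState D P ω = s ∧ detected D P N0 ω u j ≠ ω.msg u j} =
      {m} ×ˢ (R ×ˢ {d | stateDetected P N0 m s u j d ≠ m u j}) := by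
    ext ⟨m', r, d⟩
    simp only [mem_inter_iff, mem_ofPred_eq, mem_prod, mem_singleton_iff,
      detected_eq_stateDetected]
    constructor
    · rintro ⟨rfl, h, h'⟩
      rw [h] at h'
      exact ⟨rfl, h, h'⟩
    · rintro ⟨rfl, h, h'⟩
      refine ⟨rfl, h, ?_⟩
      rw [show relayState D P (m', r, d) = s from h]
      exact h'
  have h2 : {ω : Sample n | ω.1 = m} ∩ {ω | relayState D P ω = s} = {m} ×ˢ (R ×ˢ univ) := by
    ext ⟨m', r, d⟩
    simp only [mem_inter_iff, mem_ofPred_eq, mem_prod, mem_singleton_iff, mem_univ, and_true]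
    constructor
    · rintro ⟨rfl, h⟩
      exact ⟨rfl, h⟩
    · rintro ⟨rfl, h⟩
      exact ⟨rfl, h⟩
  rw [h1, h2, hμ, law, Measure.prod_prod, Measure.prod_prod, Measure.prod_prod, Measure.prod_prod,
    measure_univ, mul_one, mul_assoc]
  gcongr
  exact hB m

variable [∀ u, IsProbabilityMeasure (M u)]

/-- The law of total probability over the states of the relay. -/
lemma bitErrorProb_le (u : User) (j : Fin n) {B : RelayState → ℝ} (hB0 : ∀ s, 0 ≤ B s)
    (hB : ∀ s m, (destGainLaw ΩD).prod (destNoiseLaw n N0)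
      {d | stateDetected P N0 m s u j d ≠ m u j} ≤ ENNReal.ofReal (B s)) :
    bitErrorProb (law M ΩR ΩD NR N0) D P N0 u j ≤
      (law M ΩR ΩD NR N0).real {ω | relayState D P ω = .s0} * B .s0 +
      (law M ΩR ΩD NR N0).real {ω | relayState D P ω = .only u} * B (.only u) +
      (law M ΩR ΩD NR N0).real {ω | relayState D P ω = .only u.other} * B (.only u.other) +
      (law M ΩR ΩD NR N0).real {ω | relayState D P ω = .s3} * B .s3 := by
  set μ := law M ΩR ΩD NR N0 with hμ
  have hs (s : RelayState) :
      μ.real {ω | relayState D P ω = s ∧ detected D P N0 ω u j ≠ ω.msg u j} ≤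
        μ.real {ω | relayState D P ω = s} * B s := by
    have h := law_state_error_le M ΩR ΩD NR N0 D P s u j (hB s)
    have h' := ENNReal.toReal_mono (ENNReal.mul_ne_top (measure_ne_top _ _) ofReal_ne_top) h
    rwa [ENNReal.toReal_mul, ENNReal.toReal_ofReal (hB0 s)] at h'
  have hsub : {ω | detected D P N0 ω u j ≠ ω.msg u j} ⊆
      (({ω | relayState D P ω = .s0 ∧ detected D P N0 ω u j ≠ ω.msg u j} ∪
        {ω | relayState D P ω = .only u ∧ detected D P N0 ω u j ≠ ω.msg u j}) ∪
        {ω | relayState D P ω = .only u.other ∧ detected D P N0 ω u j ≠ ω.msg u j}) ∪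
        {ω | relayState D P ω = .s3 ∧ detected D P N0 ω u j ≠ ω.msg u j} := by
    intro ω hω
    simp only [mem_union, mem_ofPred_eq] at hω ⊢
    cases u <;> cases relayState D P ω <;> simp [RelayState.only, User.other, hω]
  calc bitErrorProb μ D P N0 u j ≤ _ := measureReal_mono hsub
    _ ≤ _ := measureReal_union_le _ _
    _ ≤ _ := by
      gcongr
      · refine (measureReal_union_le _ _).trans ?_
        gcongr
        · exact (measureReal_union_le _ _).trans (add_le_add (hs _) (hs _))
        · exact hs _
      · exact hs _

end

end MARC

open MARC in
theorem theorem1 (n : ℕ) (P N0 NR ΩD ΩR : ℝ) (hP : 0 < P) (hN0 : 0 < N0) (hNR : 0 < NR)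
    (hΩD : 0 < ΩD) (hΩR : 0 < ΩR)
    (M : MARC.User → MeasureTheory.Measure (MARC.Block n))
    (hM : ∀ u, MeasureTheory.IsProbabilityMeasure (M u))
    (D : MARC.RelayDecoder n)
    (hD : ∀ u, Measurable fun p : ℂ × (Fin n → ℂ) => D u p.1 p.2)
    (μ : MeasureTheory.Measure (MARC.Sample n)) (hμ : μ = MARC.law M ΩR ΩD NR N0)
    (p : MARC.RelayState → ℝ) (hp : p = MARC.stateProb μ D P)
    (snr : ℝ) (hsnr : snr = P / N0) :
    (∀ s : MARC.RelayState, μ.real {ω | MARC.relayState D P ω = s} = p s) ∧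
    ∀ (u : MARC.User) (j : Fin n),
      MARC.bitErrorProb μ D P N0 u j ≤
        1 / 2 * ((p .s0 + p (.only u.other)) * (ΩD / (snr + ΩD))
            + p (.only u) * (ΩD / (snr + ΩD)) ^ 2)
          + p .s3 / 4 *
            (ΩD / (ΩD + snr) * √Real.pi * ΩD ^ 2 *
                (32 * ΩD / (Real.Gamma 2.5 * (4 * ΩD + snr) ^ 3)
                    * ordinaryHypergeometric (3 : ℝ) 1.5 2.5 (snr / (4 * ΩD + snr))
                  + 4 / (Real.Gamma 2.5 * (4 * ΩD + snr) ^ 2)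
                    * ordinaryHypergeometric (2 : ℝ) 0.5 2.5 (snr / (4 * ΩD + snr)))
              + (ΩD / (ΩD + snr)) ^ 2) := by
  subst hμ hp
  have hstate := fun s => law_relayState M ΩR ΩD NR N0 D P hD s
  refine ⟨hstate, fun u j => ?_⟩
  have hs : 0 < snr := hsnr ▸ div_pos hP hN0
  have hH := (hasSum_hypergeometric_bound hΩD hs).nonneg fun n => by positivity
  set H := √Real.pi * ΩD ^ 2 * (32 * ΩD / (Real.Gamma 2.5 * (4 * ΩD + snr) ^ 3)
        * ordinaryHypergeometric (3 : ℝ) 1.5 2.5 (snr / (4 * ΩD + snr))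
      + 4 / (Real.Gamma 2.5 * (4 * ΩD + snr) ^ 2)
        * ordinaryHypergeometric (2 : ℝ) 0.5 2.5 (snr / (4 * ΩD + snr))) with hHdef
  set L := ΩD / (snr + ΩD) with hL
  have hL0 : 0 ≤ L := by positivity
  have hL' : ΩD / (ΩD + snr) = L := by rw [hL, add_comm]
  have h0 (m : User → Block n) := error_direct_le m u j hP hN0 hΩD
  have h1 (m : User → Block n) := error_mrc_le m u j hP hN0 hΩD
  have h3 (m : User → Block n) := error_both_le m u j hP hN0 hΩD
  simp only [← hsnr] at h0 h1 h3
  simp only [← hHdef, hL'] at h0 h1 h3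
  -- `B s` bounds the error probability in state `s`.
  have key : ∃ B : RelayState → ℝ, B .s0 = 1 / 2 * L ∧ B (.only u) = 1 / 2 * L ^ 2 ∧
      B (.only u.other) = 1 / 2 * L ∧ B .s3 = 1 / 4 * (L * H) + 1 / 4 * L ^ 2 := by
    cases u
    · exact ⟨fun s => match s with
        | .s0 => 1 / 2 * L
        | .s1 => 1 / 2 * L ^ 2
        | .s2 => 1 / 2 * L
        | .s3 => 1 / 4 * (L * H) + 1 / 4 * L ^ 2, rfl, rfl, rfl, rfl⟩
    · exact ⟨fun s => match s with
        | .s0 => 1 / 2 * L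
        | .s1 => 1 / 2 * L
        | .s2 => 1 / 2 * L ^ 2
        | .s3 => 1 / 4 * (L * H) + 1 / 4 * L ^ 2, rfl, rfl, rfl, rfl⟩
  obtain ⟨B, hB0, hB1, hB2, hB3⟩ := key
  have hcases : ∀ s : RelayState, s = .s0 ∨ s = .only u ∨ s = .only u.other ∨ s = .s3 := by
    intro s
    cases u <;> cases s <;> simp [RelayState.only, User.other]
  have hle := bitErrorProb_le M ΩR ΩD NR N0 D P u j (B := B) ?_ ?_
  · rw [hstate, hstate, hstate, hstate, hB0, hB1, hB2, hB3] at hle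
    refine hle.trans (le_of_eq ?_)
    rw [hL', mul_assoc L, mul_assoc L, ← hHdef]
    ring
  · intro s
    rcases hcases s with rfl | rfl | rfl | rfl
    · rw [hB0]; positivity
    · rw [hB1]; positivity
    · rw [hB2]; positivity
    · rw [hB3]; positivity
  · intro s m
    rcases hcases s with rfl | rfl | rfl | rfl
    · rw [hB0]; exact h0 m
    · rw [hB1]; exact h1 m
    · rw [hB2]
      simp only [stateDetected_other]
      exact h0 m
    · rw [hB3, ENNReal.ofReal_add (by positivity) (by positivity)]
      exact h3 m
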